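/- Let $p$ be a prime, $q=p^r$ with $r\ge 1$, and let $(\gamma_1,\dots,\gamma_r)$ be an $\mathbb F_p$-basis of $\mathbb F_q$. For a field $K$ of characteristic $p$ put $\mathcal U(K)=\{z^p-z : z\in K\}$ and $\mathcal V(K)=K/\mathcal U(K)$, an $\mathbb F_p$-vector space. Let $K=\mathbb F_q(t)$ be the rational function field and fix a separable closure $K^{\mathrm{sep}}$. Call a polynomial $U=\sum_i a_iT^i\in\mathbb F_q[T]$ reduced if $a_i=0$ for all $i>0$ with $p\mid i$. Let $L\subseteq K^{\mathrm{sep}}$ be a cyclic Galois extension of $K$ of degree $p$. "Unramified outside $t=0$" means unramified at every place of $K$ (including the place at infinity) other than the place $t=0$; "totally split at infinity" means that there are exactly $[L:K]$ places of $L$ above the place at infinity of $K$. 1. $L$ is unramified outside $t=0$ if and only if there are a reduced polynomial $U\in\mathbb F_q[T]$ and an element $y\in K^{\mathrm{sep}}$ with $y^p-y=U(1/t)$ and $L=K(y)$. 2. Whenever $L=K(y)$ with $y^p-y=U(1/t)$ and $U$ reduced with constant term $a_0$, the place at infinity is totally split in $L$ if and only if $a_0\in\mathcal U(\mathbb F_q)$,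 i.e. $a_0=0$ in $\mathcal V(\mathbb F_q)$. If $q=p$ this means $a_0=0$. 3. $L$ is unramified outside $t=0$ and totally split at infinity if and only if there are a reduced $U\in\mathbb F_q[T]$ with constant term $0$ and $y\in K^{\mathrm{sep}}$ with $y^p-y=U(1/t)$ and $L=K(y)$. 4. The classes of the elements $\gamma_j/t^i$, for $1\le j\le r$ and $i\ge 1$ with $p\nmid i$, are $\mathbb F_p$-linearly independent in $\mathcal V(K)$. 5. The cyclic extensions of $K$ of degree $p$ in $K^{\mathrm{sep}}$ that are unramified outside $t=0$ and totally split at infinity are exactly the extensions of $K$ generated by the roots of $x^p-x-u$, where $u\in K$ has a nonzero class in $\mathcal V(K)$ lying in the $\mathbb F_p$-span of the classes in 4. -/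

import Mathlib

noncomputable section

namespace ArtinSchreier

/-- The `𝔽_p`-subspace `𝒰(K) = {z ^ p - z : z ∈ K}` of a field `K` of characteristic `p`. -/
def U (p : ℕ) [Fact p.Prime] (K : Type*) [Field K] [Algebra (ZMod p) K] :
    Submodule (ZMod p) K where
  carrier := {u | ∃ z : K, z ^ p - z = u}
  zero_mem' := ⟨0, by simp [(Fact.out : p.Prime).ne_zero]⟩
  add_mem' := by
    have : CharP K p := charP_of_injective_algebraMap (algebraMap (ZMod p) K).injective p
    rintro _ _ ⟨x, rfl⟩ ⟨y, rfl⟩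
    exact ⟨x + y, by rw [add_pow_char]; ring⟩
  smul_mem' := by
    rintro c _ ⟨x, rfl⟩
    exact ⟨c • x, by rw [smul_pow, ZMod.pow_card, smul_sub]⟩

/-- The `𝔽_p`-vector space `𝒱(K) = K / 𝒰(K)`. -/
abbrev V (p : ℕ) [Fact p.Prime] (K : Type*) [Field K] [Algebra (ZMod p) K] : Type _ :=
  K ⧸ U p K

section Places

variable {K : Type*} [Field K] (L : Type*) [Field L] [Algebra K L]

/-- The valuation rings `Q` of `L` lying over the valuation ring `P` of `K`, i.e. `Q ∩ K = P`. -/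
def placesOver (P : ValuationSubring K) : Set (ValuationSubring L) :=
  {Q | Q.comap (algebraMap K L) = P}

variable (K) {L} in
/-- The ramification index of the valuation ring `Q` of `L` over `K`: the index of the
value group of `K` in the value group of `L`. -/
def ramificationIndex (Q : ValuationSubring L) : ℕ :=
  ((Units.map (Q.valuation : L →* Q.ValueGroup)).comp
    (Units.map (algebraMap K L : K →* L))).range.index

/-- `P` is unramified in `L`: all places above `P` have ramification index `1`.
(This is used only for function fields over finite fields; there all residue fields are
finite, so that residue extensions are automatically separable.) -/
def IsUnramified (P : ValuationSubring K) : Prop :=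
  ∀ Q ∈ placesOver L P, ramificationIndex K Q = 1

/-- `P` splits totally in `L`: there are exactly `[L : K]` distinct places of `L` above `P`. -/
def IsTotallySplit (P : ValuationSubring K) : Prop :=
  (placesOver L P).ncard = Module.finrank K L

end Places

section RationalFunctionField

variable (F : Type*) [Field F]

/-- The place `t = 0` of `F(t)`. -/
def zeroPlace : ValuationSubring (RatFunc F) :=
  ((Polynomial.idealX F).valuation (RatFunc F)).valuationSubring

open Classical in
/-- The place at infinity of `F(t)`. -/
def inftyPlace : ValuationSubring (RatFunc F) :=
  (RatFunc.inftyValuation F).valuationSubring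

/-- `L / F(t)` is unramified outside `t = 0`, for `F` a finite field. The places of `F(t)` are its
valuation rings other than `F(t)` itself (they contain `F`, whose nonzero elements are roots of
unity), the place at infinity included. -/
def IsUnramifiedOutsideZero (L : Type*) [Field L] [Algebra (RatFunc F) L] : Prop :=
  ∀ P : ValuationSubring (RatFunc F), P ≠ ⊤ → P ≠ zeroPlace F → IsUnramified L P

variable {F}

/-- The element `W(1/t)` of `F(t)`, for a polynomial `W` over `F`. -/
def evalInv (W : Polynomial F) : RatFunc F :=
  Polynomial.aeval (RatFunc.X : RatFunc F)⁻¹ W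

/-- All the monomials of positive degree divisible by `p` are missing from `W`. -/
def IsReduced (p : ℕ) (W : Polynomial F) : Prop :=
  ∀ i, 0 < i → p ∣ i → W.coeff i = 0

end RationalFunctionField

section Extensions

variable (p : ℕ) {K : Type*} [Field K] {Ω : Type*} [Field Ω] [Algebra K Ω]

/-- `L / K` is a separable cyclic extension of degree `p`. -/
def IsCyclicOfDegree (L : IntermediateField K Ω) : Prop :=
  IsGalois K L ∧ IsCyclic (L ≃ₐ[K] L) ∧ Module.finrank K L = p

/-- `L = K(y)` with `y ^ p - y = u`. -/
def IsGeneratedBy (L : IntermediateField K Ω) (u : K) (y : Ω) : Prop :=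
  y ^ p - y = algebraMap K Ω u ∧ L = IntermediateField.adjoin K {y}

variable (Ω) in
/-- The extension of `K` inside `Ω` that Artin-Schreier theory attaches to `u`: it is
generated by the roots of `x ^ p - x - u`. -/
def extensionOf (u : K) : IntermediateField K Ω :=
  IntermediateField.adjoin K {y : Ω | y ^ p - y = algebraMap K Ω u}

end Extensions

/-- The family of the classes of `γ j / t ^ i` in `𝒱(F(t))`, for `j` an index of the family `γ`
and `i` a positive integer not divisible by `p`. -/
def S (p : ℕ) [Fact p.Prime] {F : Type*} [Field F] [Algebra (ZMod p) F] {r : ℕ}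
    (γ : Fin r → F) (x : Fin r × {i : ℕ // 0 < i ∧ ¬ p ∣ i}) : V p (RatFunc F) :=
  (U p (RatFunc F)).mkQ (RatFunc.C (γ x.1) / RatFunc.X ^ (x.2 : ℕ))

end ArtinSchreier

end

namespace ArtinSchreier

open Polynomial IntermediateField

/-! ### Artin–Schreier theory in characteristic `p`. -/

section Algebra

/-! Write `℘(z) = z ^ p - z`. By Artin–Schreier theory (`exists_generator`,
`isCyclicOfDegree_adjoin`) the cyclic extensions of degree `p` are the `K(y)` with `℘(y) = u`, where
`u` is not in `℘(K)`. Replacing `y` by `y - a` changes `u` by `℘(a)`, so everything depends on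
choosing `u` well in its class and on reading off the behaviour of a place `P` from `u`.

If `u` has a pole of order prime to `p` at a discrete place, that place ramifies, since `v(u) = v(y)
^ p` cannot hold with `v(y)` a value of `K` (`not_isUnramified`). If `u` is integral at `P`, then
`P` is unramified (`isUnramified_of_mem`). Either `℘(x) = u` has no solution in the residue field
and only one place lies above `P`, or a translation makes `u` vanish at `P`, and `P` splits into `p`
places told apart by the residue of `y` in `𝔽_p` (`ncard_placesOver_of_split`).

The residue fields of `F(t)` are perfect, so pole orders divisible by `p` at finite places can be
removed modulo `℘` (`exists_sub_eq_div`). If `L` is unramified outside `0`, the remaining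
denominator is a power of `t`. Once its polynomial part is reduced too, a pole at infinity would
also ramify, so `u = W(1/t)` with `W` reduced (`exists_isReduced_of_isUnramifiedOutsideZero`). At
infinity `W(1/t)` has residue `W.coeff 0` in the residue field `F`, whence the splitting criterion
(`isTotallySplit_inftyPlace_iff`).

Finally, a nonconstant reduced polynomial in `1/t` has a pole at `0` of order prime to `p` and so is
not in `℘(F(t))` (`natDegree_eq_zero_of_evalInv_eq`). This gives the linear independence;
`mem_span_S_iff` identifies the span with the classes of the reduced `W(1/t)` without constant term.
-/

theorem separable_X_pow_sub_X_sub_C {p : ℕ} {E : Type*} [Field E] [CharP E p] (u : E) :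
    (X ^ p - X - C u : E[X]).Separable := by
  rw [separable_def]
  have : derivative (X ^ p - X - C u : E[X]) = -1 := by simp [derivative_X_pow]
  rw [this]
  exact isCoprime_one_right.neg_right

variable {p : ℕ} [hp : Fact p.Prime]

theorem exists_castHom_eq_of_pow_eq_self {E : Type*} [Field E] [CharP E p] {x : E}
    (hx : x ^ p = x) : ∃ c : ZMod p, ZMod.castHom (dvd_refl p) E c = x := by
  have h := (Subfield.mem_bot_iff_pow_eq_self E p (x := x)).2 hx
  have : (⊥ : Subfield E) ≤ (ZMod.castHom (dvd_refl p) E).fieldRange := bot_le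
  exact this h

theorem castHom_pow {E : Type*} [Field E] [CharP E p] (c : ZMod p) :
    (ZMod.castHom (dvd_refl p) E c) ^ p = ZMod.castHom (dvd_refl p) E c := by
  rw [← map_pow, ZMod.pow_card]

theorem add_pow_sub_add {E : Type*} [Field E] [CharP E p] (x y : E) :
    (x + y) ^ p - (x + y) = (x ^ p - x) + (y ^ p - y) := by
  rw [add_pow_char]; ring

theorem sub_pow_sub_sub {E : Type*} [Field E] [CharP E p] (x y : E) :
    (x - y) ^ p - (x - y) = (x ^ p - x) - (y ^ p - y) := by
  rw [sub_pow_char]; ring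

theorem exists_castHom_eq_sub {E : Type*} [Field E] [CharP E p] {x y : E}
    (h : x ^ p - x = y ^ p - y) : ∃ c : ZMod p, ZMod.castHom (dvd_refl p) E c = x - y := by
  apply exists_castHom_eq_of_pow_eq_self
  rw [← sub_eq_zero, sub_pow_sub_sub, h, sub_self]

theorem splits_X_pow_sub_X (E : Type*) [Field E] [CharP E p] :
    (X ^ p - X : E[X]).Splits := by
  have h := (FiniteField.splits_X_pow_card_sub_X p (K := ZMod p)).map (ZMod.castHom (dvd_refl p) E)
  simpa [ZMod.card] using h

theorem splits_X_pow_sub_X_sub_C {E : Type*} [Field E] [CharP E p] (y : E) :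
    (X ^ p - X - C (y ^ p - y) : E[X]).Splits := by
  have h := (splits_X_pow_sub_X (p := p) E).comp_X_sub_C y
  have e : (X ^ p - X - C (y ^ p - y) : E[X]) = (X ^ p - X : E[X]).comp (X - C y) := by
    simp [sub_pow_char]; ring
  rwa [e]

theorem adjoin_gen_eq_top {K E : Type*} [Field K] [Field E] [Algebra K E] (y : E) :
    K⟮AdjoinSimple.gen K y⟯ = ⊤ := by
  apply lift_injective
  rw [lift_adjoin_simple, lift_top, AdjoinSimple.coe_gen]

section Extension

variable {K E : Type*} [Field K] [Field E] [Algebra K E] {y : E} {u : K}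

theorem isIntegral_root (hy : y ^ p - y = algebraMap K E u) : IsIntegral K y := by
  refine ⟨X ^ p - X - C u, ?_, ?_⟩
  · have : (X ^ p - X - C u : K[X]) = X ^ p - (X + C u) := by ring
    rw [this]
    refine monic_X_pow_sub (lt_of_le_of_lt (degree_X_add_C u).le ?_)
    exact_mod_cast hp.out.one_lt
  · simp [hy]

theorem exists_aeval_eq (hy : y ^ p - y = algebraMap K E u) (hgen : K⟮y⟯ = ⊤) (z : E) :
    ∃ g : K[X], aeval y g = z := by
  have hz : z ∈ K⟮y⟯.toSubalgebra := by rw [hgen]; exact mem_top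
  rwa [adjoin_simple_toSubalgebra_of_isAlgebraic (isIntegral_root hy).isAlgebraic,
    Algebra.adjoin_singleton_eq_range_aeval] at hz

variable [CharP E p]

/-- The homomorphism from the Galois group to `𝔽_p` that sends `σ` to `σ y - y`. -/
theorem exists_hom_gal (hy : y ^ p - y = algebraMap K E u) (hgen : K⟮y⟯ = ⊤) :
    ∃ φ : (E ≃ₐ[K] E) →* Multiplicative (ZMod p), Function.Injective φ ∧
      ∀ σ, σ y = y + ZMod.castHom (dvd_refl p) E (φ σ).toAdd := by
  have h (σ : E ≃ₐ[K] E) : ∃ c : ZMod p, ZMod.castHom (dvd_refl p) E c = σ y - y := by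
    apply exists_castHom_eq_sub
    rw [← map_pow, ← map_sub, hy, σ.commutes]
  choose φ hφ using h
  have hφ' (σ : E ≃ₐ[K] E) : σ y = y + ZMod.castHom (dvd_refl p) E (φ σ) := by
    rw [hφ]; ring
  refine ⟨MonoidHom.mk' (fun σ => Multiplicative.ofAdd (φ σ)) ?_, ?_, hφ'⟩
  · intro σ τ
    rw [← ofAdd_add]
    congr 1
    apply (ZMod.castHom (dvd_refl p) E).injective
    rw [hφ, map_add, AlgEquiv.mul_apply, hφ' τ, map_add, hφ' σ]
    rw [show σ (ZMod.castHom (dvd_refl p) E (φ τ)) = ZMod.castHom (dvd_refl p) E (φ τ) from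
      RingHom.congr_fun (RingHom.ext_zmod ((σ : E →+* E).comp (ZMod.castHom (dvd_refl p) E)) _) _]
    ring
  · intro σ τ hστ
    have h1 : σ y = τ y := by
      rw [hφ', hφ']
      congr 2
    ext z
    obtain ⟨g, rfl⟩ := exists_aeval_eq hy hgen z
    rw [← aeval_algHom_apply σ, ← aeval_algHom_apply τ, h1]

variable [CharP K p]

/-- Two roots differ by an element of `𝔽_p`, which already lies in `K`, so one root generates all of
them. -/
theorem extensionOf_eq_adjoin (hy : y ^ p - y = algebraMap K E u) :
    extensionOf p E u = K⟮y⟯ := by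
  apply le_antisymm
  · rw [extensionOf, adjoin_le_iff]
    intro z hz
    obtain ⟨c, hc⟩ := exists_castHom_eq_sub (hz.trans hy.symm)
    have : z = y + algebraMap K E (ZMod.castHom (dvd_refl p) K c) := by
      rw [← RingHom.comp_apply, RingHom.ext_zmod ((algebraMap K E).comp _)
        (ZMod.castHom (dvd_refl p) E), hc]
      ring
    rw [this]
    exact add_mem (mem_adjoin_simple_self K y) (K⟮y⟯.algebraMap_mem _)
  · exact adjoin.mono _ _ _ (by simpa using hy)

theorem isGalois_adjoin (hy : y ^ p - y = algebraMap K E u) : IsGalois K K⟮y⟯ := by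
  have hs : IsSplittingField K K⟮y⟯ (X ^ p - X - C u : K[X]) := by
    rw [isSplittingField_iff]
    constructor
    · have h' : (AdjoinSimple.gen K y) ^ p - AdjoinSimple.gen K y = algebraMap K K⟮y⟯ u := by
        apply (algebraMap K⟮y⟯ E).injective
        simpa using hy
      have : CharP K⟮y⟯ p := charP_of_injective_algebraMap (algebraMap K K⟮y⟯).injective p
      rw [show (X ^ p - X - C u : K[X]).map (algebraMap K K⟮y⟯) = X ^ p - X - C (_ ^ p - _) by
        rw [h']; simp]
      exact splits_X_pow_sub_X_sub_C _
    · rw [← extensionOf_eq_adjoin hy, extensionOf]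
      congr 1
      ext z
      have hm : (X ^ p - X - C u : K[X]).map (algebraMap K E) ≠ 0 := by
        rw [show (X ^ p - X - C u : K[X]).map (algebraMap K E) = X ^ p - X - C (y ^ p - y) by
          simp [hy]]
        intro h0
        have := separable_X_pow_sub_X_sub_C (p := p) (y ^ p - y)
        rw [h0] at this
        exact not_separable_zero this
      rw [mem_rootSet']
      simp only [hm, ne_eq, not_false_eq_true, true_and]
      simp [sub_eq_zero]
  exact IsGalois.of_separable_splitting_field (separable_X_pow_sub_X_sub_C u)

/-- The Galois group embeds into `𝔽_p` by `σ ↦ σ y - y`, so its order is `1` or `p`; order `1` would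
put the root `y` into `K`. -/
theorem finrank_of_not_exists (hy : y ^ p - y = algebraMap K E u) (hgen : K⟮y⟯ = ⊤)
    (hu : ∀ z : K, z ^ p - z ≠ u) : Module.finrank K E = p := by
  have : FiniteDimensional K K⟮y⟯ := adjoin.finiteDimensional (isIntegral_root hy)
  have := isGalois_adjoin hy
  rw [hgen] at this ‹FiniteDimensional K K⟮y⟯›
  have : FiniteDimensional K E := topEquiv.toLinearEquiv.finiteDimensional
  have : IsGalois K E := .of_algEquiv topEquiv
  obtain ⟨φ, hφ, hσ⟩ := exists_hom_gal hy hgen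
  have hd := Subgroup.card_dvd_of_injective φ hφ
  rw [IsGalois.card_aut_eq_finrank] at hd
  have hc : Nat.card (Multiplicative (ZMod p)) = p := by
    rw [Nat.card_congr Multiplicative.toAdd, Nat.card_zmod]
  rw [hc] at hd
  refine ((Nat.dvd_prime hp.out).1 hd).resolve_left fun h1 => ?_
  rw [← IntermediateField.finrank_top', ← hgen, finrank_adjoin_simple_eq_one_iff, mem_bot] at h1
  obtain ⟨z, hz⟩ := h1
  apply hu z
  apply (algebraMap K E).injective
  rw [← hy, ← hz]; simp

theorem isCyclicOfDegree_adjoin (hy : y ^ p - y = algebraMap K E u)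
    (hu : ∀ z : K, z ^ p - z ≠ u) : IsCyclicOfDegree p K⟮y⟯ := by
  have : FiniteDimensional K K⟮y⟯ := adjoin.finiteDimensional (isIntegral_root hy)
  have hG := isGalois_adjoin hy
  have : CharP K⟮y⟯ p := charP_of_injective_algebraMap (algebraMap K K⟮y⟯).injective p
  have h' : (AdjoinSimple.gen K y) ^ p - AdjoinSimple.gen K y = algebraMap K K⟮y⟯ u := by
    apply (algebraMap K⟮y⟯ E).injective
    simpa using hy
  have hf := finrank_of_not_exists h' (adjoin_gen_eq_top y) hu
  exact ⟨hG, isCyclic_of_prime_card ((IsGalois.card_aut_eq_finrank _ _).trans hf), hf⟩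

/-- Artin-Schreier: a cyclic extension of degree `p` in characteristic `p` is generated by a root
of some `x ^ p - x - u`. -/
theorem exists_generator [IsGalois K E] [IsCyclic (E ≃ₐ[K] E)] (hd : Module.finrank K E = p) :
    ∃ (y : E) (u : K), y ^ p - y = algebraMap K E u ∧ K⟮y⟯ = ⊤ := by
  have : FiniteDimensional K E := .of_finrank_pos (hd ▸ hp.out.pos)
  obtain ⟨σ, hσ⟩ := IsCyclic.exists_generator (α := E ≃ₐ[K] E)
  have hfix (z : E) (hz : σ z = z) : ∃ a, algebraMap K E a = z := by
    suffices z ∈ (⊥ : IntermediateField K E) from mem_bot.1 this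
    rw [IsGalois.mem_bot_iff_fixed]
    intro τ
    have : Subgroup.zpowers σ ≤ MulAction.stabilizer (E ≃ₐ[K] E) z := by
      rw [Subgroup.zpowers_le]; exact hz
    exact this (hσ τ)
  let N : Module.End K E := (σ : E →ₐ[K] E).toLinearMap - 1
  have hN (z : E) : N z = σ z - z := rfl
  have hcard : Nat.card (E ≃ₐ[K] E) = p := (IsGalois.card_aut_eq_finrank K E).trans hd
  -- In characteristic `p` the commuting operators satisfy `(σ - 1) ^ p = σ ^ p - 1`, and `σ` has
  -- order dividing `p`.
  have hNp : N ^ p = 0 := by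
    have hc : CharP (Module.End K E) p :=
      charP_of_injective_algebraMap (algebraMap K (Module.End K E)).injective p
    have h1 : ((σ : E →ₐ[K] E).toLinearMap : Module.End K E) ^ p = 1 := by
      ext z
      have : ∀ n : ℕ, (((σ : E →ₐ[K] E).toLinearMap : Module.End K E) ^ n) z = (σ ^ n) z := by
        intro n
        induction n with
        | zero => simp
        | succ n ih => rw [pow_succ', pow_succ', Module.End.mul_apply, ih]; rfl
      rw [this, ← hcard, pow_card_eq_one']; rfl
    rw [sub_pow_char_of_commute p (Commute.one_right _), h1, one_pow, sub_self]
  -- A nonzero nilpotent operator has a vector killed by `N ^ 2` but not by `N`. Otherwise `N ^ p =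
  -- 0` would descend to `N = 0`, making the generator `σ` trivial.
  have hex : ∃ x, N x ≠ 0 ∧ N (N x) = 0 := by
    by_contra! hcon
    have hinj : ∀ n : ℕ, ∀ x, (N ^ (n + 1)) x = 0 → N x = 0 := by
      intro n
      induction n with
      | zero => intro x hx; simpa using hx
      | succ n ih =>
        intro x hx
        rw [pow_succ, Module.End.mul_apply] at hx
        by_contra h0
        exact hcon x h0 (ih _ hx)
    have hN0 (x : E) : σ x = x := by
      have := hinj (p - 1) x (by rw [Nat.sub_add_cancel hp.out.one_le, hNp]; rfl)
      rwa [hN, sub_eq_zero] at this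
    have hσ1 : σ = 1 := AlgEquiv.ext hN0
    have : Nat.card (E ≃ₐ[K] E) = 1 := by
      refine Nat.card_eq_one_iff_unique.2 ⟨⟨fun τ τ' => ?_⟩, ⟨1⟩⟩
      have hall (ρ : E ≃ₐ[K] E) : ρ = 1 := by simpa [hσ1] using hσ ρ
      rw [hall τ, hall τ']
    exact hp.out.one_lt.ne' (hcard ▸ this)
  obtain ⟨x, hx0, hx⟩ := hex
  rw [hN, sub_eq_zero] at hx
  obtain ⟨a, ha⟩ := hfix _ hx
  have ha0 : algebraMap K E a ≠ 0 := ha ▸ hx0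
  -- With `N x = a` fixed by `σ`, division by `a` normalises the translation to `1`; then `℘` of the
  -- quotient is fixed, since `℘(1) = 0`.
  have hσy : σ (x / algebraMap K E a) = x / algebraMap K E a + 1 := by
    rw [map_div₀, σ.commutes]
    field_simp
    rw [ha, hN]; ring
  obtain ⟨u, hu⟩ := hfix ((x / algebraMap K E a) ^ p - x / algebraMap K E a) (by
    rw [map_sub, map_pow, hσy, add_pow_sub_add]; simp)
  refine ⟨_, u, hu.symm, ?_⟩
  have := isSimpleOrder_of_finrank_prime K E (hd ▸ hp.out)
  refine (eq_bot_or_eq_top _).resolve_left fun h => ?_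
  rw [adjoin_simple_eq_bot_iff, mem_bot] at h
  obtain ⟨b, hb⟩ := h
  rw [← hb, σ.commutes] at hσy
  simp at hσy

end Extension
end Algebra

/-! ### Valuations of `y ^ p - y`. -/

section Valuation

theorem one_lt_valuation_of_pow_sub_self {p : ℕ} {E Γ : Type*} [Field E]
    [LinearOrderedCommGroupWithZero Γ] (v : Valuation E Γ) {y : E} (hy : 1 < v (y ^ p - y)) :
    1 < v y := by
  by_contra! h
  refine absurd hy (not_lt.2 (v.map_sub_le ?_ h))
  rw [map_pow]
  exact pow_le_one' h p

variable {p : ℕ} [hp : Fact p.Prime] {E Γ : Type*} [Field E] [LinearOrderedCommGroupWithZero Γ]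
  (v : Valuation E Γ)

theorem valuation_pow_sub_self {y : E} (hy : 1 < v y) : v (y ^ p - y) = v y ^ p := by
  rw [Valuation.map_sub_eq_of_lt_left, map_pow]
  rw [map_pow]
  exact lt_self_pow₀ hy hp.out.one_lt

theorem valuation_le_one_of_pow_sub_self {y : E} (hy : v (y ^ p - y) ≤ 1) : v y ≤ 1 := by
  by_contra! h
  rw [valuation_pow_sub_self v h] at hy
  exact absurd hy (not_le.2 (one_lt_pow₀ h hp.out.ne_zero))

theorem valuation_castHom [CharP E p] {c : ZMod p} (hc : c ≠ 0) :
    v (ZMod.castHom (dvd_refl p) E c) = 1 := by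
  have h1 : v (ZMod.castHom (dvd_refl p) E c) ^ (p - 1) = 1 := by
    rw [← map_pow, ← map_pow, ZMod.pow_card_sub_one_eq_one hc, map_one, map_one]
  exact (pow_eq_one_iff_of_nonneg zero_le (Nat.sub_ne_zero_of_lt hp.out.one_lt)).1 h1

end Valuation

/-! ### Places above a given place, and ramification. -/

section Places

variable {K L : Type*} [Field K] [Field L] [Algebra K L] {P : ValuationSubring K}
  {Q : ValuationSubring L}

/-- A valuation ring of `L` dominating the image of the local ring `P` works. If `x` lay in `Q` but
not in `P`, then `x⁻¹` would be a nonunit of `P` that becomes a unit in `Q`, against domination. -/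
theorem exists_mem_placesOver (P : ValuationSubring K) : ∃ Q, Q ∈ placesOver L P := by
  obtain ⟨Q, hle, hloc⟩ :=
    (P.toLocalSubring.map (algebraMap K L)).exists_le_valuationSubring
  refine ⟨Q, ?_⟩
  have hPQ (x : K) (hx : x ∈ P) : algebraMap K L x ∈ Q := hle ⟨x, hx, rfl⟩
  ext x
  refine ⟨fun hx => ?_, hPQ x⟩
  by_contra hxP
  have hx0 : x ≠ 0 := fun h => hxP (h ▸ P.zero_mem)
  have hxi : x⁻¹ ∈ P := (P.mem_or_inv_mem x).resolve_left hxP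
  have hu : IsUnit (Subring.inclusion hle ⟨algebraMap K L x⁻¹, ⟨x⁻¹, hxi, rfl⟩⟩) := by
    refine IsUnit.of_mul_eq_one ⟨algebraMap K L x, hx⟩ (Subtype.ext ?_)
    change algebraMap K L x⁻¹ * algebraMap K L x = 1
    rw [← map_mul, inv_mul_cancel₀ hx0, map_one]
  obtain ⟨⟨_, ⟨a, ha, rfl⟩⟩, hb⟩ := (hloc.map_nonunit _ hu).exists_right_inv
  have hb' : algebraMap K L x⁻¹ * algebraMap K L a = 1 := congrArg Subtype.val hb
  rw [← map_mul, ← map_one (algebraMap K L)] at hb'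
  have h := (algebraMap K L).injective hb'
  rw [inv_mul_eq_one₀ hx0] at h
  exact hxP (h ▸ ha)

theorem algebraMap_mem_iff (hQ : Q ∈ placesOver L P) {x : K} : algebraMap K L x ∈ Q ↔ x ∈ P := by
  rw [← (show Q.comap (algebraMap K L) = P from hQ)]; rfl

theorem isEquiv_comap (hQ : Q ∈ placesOver L P) :
    (Q.valuation.comap (algebraMap K L)).IsEquiv P.valuation := by
  rw [Valuation.isEquiv_iff_val_le_one]
  intro x
  rw [Valuation.comap_apply, ValuationSubring.valuation_le_one_iff,
    ValuationSubring.valuation_le_one_iff, algebraMap_mem_iff hQ]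

theorem valuation_algebraMap_lt_one_iff (hQ : Q ∈ placesOver L P) {x : K} :
    Q.valuation (algebraMap K L x) < 1 ↔ P.valuation x < 1 :=
  (isEquiv_comap hQ).lt_one_iff_lt_one

theorem valuation_algebraMap_lt_iff (hQ : Q ∈ placesOver L P) {x y : K} :
    Q.valuation (algebraMap K L x) < Q.valuation (algebraMap K L y) ↔
      P.valuation x < P.valuation y :=
  (isEquiv_comap hQ).lt_iff_lt

theorem ramificationIndex_eq_one_iff :
    ramificationIndex K Q = 1 ↔
      ∀ z : L, z ≠ 0 → ∃ c : K, Q.valuation z = Q.valuation (algebraMap K L c) := by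
  rw [ramificationIndex, Subgroup.index_eq_one, MonoidHom.range_eq_top]
  constructor
  · intro h z hz
    obtain ⟨c, hc⟩ := h (Units.map (Q.valuation : L →* Q.ValueGroup) (Units.mk0 z hz))
    exact ⟨c, (congrArg Units.val hc).symm⟩
  · intro h g
    obtain ⟨z, hz⟩ := Q.valuation_surjective g
    have hz0 : z ≠ 0 := by
      rintro rfl
      rw [map_zero] at hz
      exact g.ne_zero hz.symm
    obtain ⟨c, hc⟩ := h z hz0
    have hc0 : c ≠ 0 := by
      rintro rfl
      rw [map_zero, map_zero, hz] at hc
      exact g.ne_zero hc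
    exact ⟨Units.mk0 c hc0, Units.ext (hc.symm.trans hz)⟩

/-- A set of places over `P` on which all elements of `L` have the valuation of an element of `K`,
the same at all places of the set, has at most one element. -/
theorem eq_of_forall_exists_valuation_eq {S : Set (ValuationSubring L)} (hS : S ⊆ placesOver L P)
    (h : ∀ z : L, z ≠ 0 → ∃ c : K, ∀ Q ∈ S, Q.valuation z = Q.valuation (algebraMap K L c))
    {Q Q' : ValuationSubring L} (hQ : Q ∈ S) (hQ' : Q' ∈ S) : Q = Q' := by
  ext z
  rcases eq_or_ne z 0 with rfl | hz
  · simp [Q.zero_mem, Q'.zero_mem]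
  obtain ⟨c, hc⟩ := h z hz
  rw [← Q.valuation_le_one_iff, ← Q'.valuation_le_one_iff, hc Q hQ, hc Q' hQ',
    Q.valuation_le_one_iff, Q'.valuation_le_one_iff, algebraMap_mem_iff (hS hQ),
    algebraMap_mem_iff (hS hQ')]

/-- Scaling of a polynomial to one with coefficients in `P`, not all of them nonunits. -/
theorem exists_eq_C_mul_map (P : ValuationSubring K) {g : K[X]} (hg : g ≠ 0) :
    ∃ (c : K) (h : P[X]), c ≠ 0 ∧ g = C c * h.map P.subtype ∧ ∃ i, h.coeff i = 1 := by
  obtain ⟨i, hi, hmax⟩ := g.support.exists_max_image (fun i => P.valuation (g.coeff i))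
    (nonempty_support_iff.2 hg)
  have hc : g.coeff i ≠ 0 := mem_support_iff.1 hi
  have hmem : C (g.coeff i)⁻¹ * g ∈ lifts P.subtype := by
    rw [lifts_iff_coeff_lifts]
    intro n
    have : (C (g.coeff i)⁻¹ * g).coeff n ∈ P := by
      rw [coeff_C_mul, ← P.valuation_le_one_iff, map_mul, map_inv₀]
      rw [inv_mul_le_one₀ (by simpa [zero_lt_iff] using hc)]
      by_cases hn : n ∈ g.support
      · exact hmax n hn
      · rw [notMem_support_iff.1 hn, map_zero]; exact zero_le
    exact ⟨⟨_, this⟩, rfl⟩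
  obtain ⟨h, hh⟩ := hmem
  have hh' : h.map P.subtype = C (g.coeff i)⁻¹ * g := hh
  refine ⟨g.coeff i, h, hc, ?_, i, ?_⟩
  · rw [hh', ← mul_assoc, ← C_mul, mul_inv_cancel₀ hc, C_1, one_mul]
  · apply P.subtype_injective
    rw [← coeff_map, hh', coeff_C_mul, inv_mul_cancel₀ hc, map_one]

/-- The ring homomorphism between the valuation rings of a place and of one over it. -/
def placeHom (hQ : Q ∈ placesOver L P) : P →+* Q :=
  ((algebraMap K L).comp P.subtype).codRestrict Q.toSubring
    fun x => (algebraMap_mem_iff hQ).2 x.2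

theorem isLocalHom_placeHom (hQ : Q ∈ placesOver L P) : IsLocalHom (placeHom hQ) := by
  refine ⟨fun x hx => ?_⟩
  rw [← not_not (a := IsUnit x), ← mem_nonunits_iff, ← IsLocalRing.mem_maximalIdeal,
    P.valuation_lt_one_iff, ← valuation_algebraMap_lt_one_iff hQ]
  have h := (Q.valuation_eq_one_iff _).1 hx
  exact h.not_lt

theorem coe_eval₂_placeHom (hQ : Q ∈ placesOver L P) (y : Q) (h : P[X]) :
    ((h.eval₂ (placeHom hQ) y : Q) : L) = aeval (y : L) (h.map P.subtype) := by
  change Q.subtype _ = _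
  rw [hom_eval₂, aeval_def, eval₂_map]
  rfl

theorem aeval_map_mem (hQ : Q ∈ placesOver L P) {y : L} (hy : y ∈ Q) (h : P[X]) :
    aeval y (h.map P.subtype) ∈ Q := by
  rw [← coe_eval₂_placeHom hQ ⟨y, hy⟩]
  exact SetLike.coe_mem _

theorem charP_residueField {p : ℕ} [hp : Fact p.Prime] [CharP K p] (P : ValuationSubring K) :
    CharP (IsLocalRing.ResidueField P) p := by
  rw [CharP.charP_iff_prime_eq_zero hp.out, ← map_natCast (IsLocalRing.residue P)]
  have : (p : P) = 0 := Subtype.ext (by simp)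
  rw [this, map_zero]

end Places

/-! ### Comparing values of elements of `L` with values of elements of `K`. -/

section

variable {p : ℕ} [hp : Fact p.Prime] {K L : Type*} [Field K] [Field L] [Algebra K L]
  {P : ValuationSubring K} {y : L} {u : K}

theorem exists_aeval_eq_of_degree_lt (hy : y ^ p - y = algebraMap K L u) (hgen : K⟮y⟯ = ⊤)
    (z : L) : ∃ g : K[X], g.degree < p ∧ aeval y g = z := by
  obtain ⟨g, rfl⟩ := exists_aeval_eq hy hgen z
  have hd : (X + C u : K[X]).degree < (p : ℕ) :=
    lt_of_le_of_lt (degree_X_add_C u).le (by exact_mod_cast hp.out.one_lt)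
  have hm : (X ^ p - (X + C u) : K[X]).Monic := monic_X_pow_sub hd
  refine ⟨g %ₘ (X ^ p - (X + C u)), ?_, ?_⟩
  · have h := degree_modByMonic_lt g hm
    rwa [degree_sub_eq_left_of_degree_lt (by rwa [degree_X_pow]), degree_X_pow] at h
  · conv_rhs => rw [← modByMonic_add_div g (X ^ p - (X + C u))]
    have : aeval y (X ^ p - (X + C u)) = 0 := by
      simp [← hy]
    rw [map_add, map_mul, this, zero_mul, add_zero]

theorem mem_of_pow_sub_self (hy : y ^ p - y = algebraMap K L u) (hu : u ∈ P)
    {Q : ValuationSubring L} (hQ : Q ∈ placesOver L P) : y ∈ Q := by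
  rw [← Q.valuation_le_one_iff]
  apply valuation_le_one_of_pow_sub_self (p := p)
  rw [hy, Q.valuation_le_one_iff]
  exact (algebraMap_mem_iff hQ).2 hu

/-- Write `z = c * h(y)` with `h` of degree less than `p`, integral over `P` and nonzero modulo `P`.
The residue of `y` has degree `p` over the residue field, so `h` cannot vanish there, and `h(y)` is
a unit. The constant `c` does not depend on `Q`, which also yields that at most one place lies above
`P`. -/
theorem exists_valuation_eq_of_inert [CharP K p] (hy : y ^ p - y = algebraMap K L u)
    (hgen : K⟮y⟯ = ⊤) (hu : u ∈ P) (hinert : ∀ z ∈ P, ¬ P.valuation (z ^ p - z - u) < 1)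
    {z : L} (hz : z ≠ 0) :
    ∃ c : K, ∀ Q ∈ placesOver L P, Q.valuation z = Q.valuation (algebraMap K L c) := by
  have : CharP L p := charP_of_injective_algebraMap (algebraMap K L).injective p
  obtain ⟨g, hgd, rfl⟩ := exists_aeval_eq_of_degree_lt hy hgen z
  have hg : g ≠ 0 := fun h => hz (by rw [h, map_zero])
  obtain ⟨c, h, hc, rfl, i, hi⟩ := exists_eq_C_mul_map P hg
  refine ⟨c, fun Q hQ => ?_⟩
  have hyQ := mem_of_pow_sub_self hy hu hQ
  suffices hv : Q.valuation (aeval y (h.map P.subtype)) = 1 by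
    rw [map_mul, aeval_C, map_mul, hv, mul_one]
  rw [← coe_eval₂_placeHom hQ ⟨y, hyQ⟩, ← Q.valuation_eq_one_iff,
    ← IsLocalRing.residue_ne_zero_iff_isUnit]
  have := isLocalHom_placeHom hQ
  have := charP_residueField (p := p) P
  have := charP_residueField (p := p) Q
  let φ := IsLocalRing.ResidueField.map (placeHom hQ)
  let := φ.toAlgebra
  have hφ : (IsLocalRing.residue Q).comp (placeHom hQ) = φ.comp (IsLocalRing.residue P) := rfl
  set k := IsLocalRing.ResidueField P
  rw [hom_eval₂, hφ, ← eval₂_map]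
  change aeval (IsLocalRing.residue Q ⟨y, hyQ⟩) (h.map (IsLocalRing.residue P)) ≠ 0
  set w := IsLocalRing.residue Q ⟨y, hyQ⟩ with hw
  have hwu : w ^ p - w = algebraMap k _ (IsLocalRing.residue P ⟨u, hu⟩) := by
    change _ = IsLocalRing.residue Q (placeHom hQ ⟨u, hu⟩)
    rw [hw, ← map_pow, ← map_sub]
    exact congrArg _ (Subtype.ext hy)
  have hwu' : (AdjoinSimple.gen k w) ^ p - AdjoinSimple.gen k w =
      algebraMap k k⟮w⟯ (IsLocalRing.residue P ⟨u, hu⟩) := by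
    apply (algebraMap k⟮w⟯ (IsLocalRing.ResidueField Q)).injective
    simpa using hwu
  have : CharP k⟮w⟯ p := charP_of_injective_algebraMap (algebraMap k k⟮w⟯).injective p
  -- A root of the residue equation in `k` would lift to some `z ∈ P` excluded by `hinert`.
  have hdeg : (minpoly k w).natDegree = p := by
    rw [← adjoin.finrank (isIntegral_root hwu)]
    refine finrank_of_not_exists hwu' (adjoin_gen_eq_top w) fun z hz => ?_
    obtain ⟨z, rfl⟩ := IsLocalRing.residue_surjective z
    refine hinert z z.2 ?_
    rw [← map_pow, ← map_sub, ← sub_eq_zero, ← map_sub, IsLocalRing.residue_eq_zero_iff,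
      P.valuation_lt_one_iff] at hz
    exact hz
  intro h0
  have hne : h.map (IsLocalRing.residue P) ≠ 0 := by
    intro h0
    have := congrArg (coeff · i) h0
    simp [hi] at this
  have hle := minpoly.degree_le_of_ne_zero k w hne h0
  rw [degree_eq_natDegree (minpoly.ne_zero (isIntegral_root hwu)), hdeg] at hle
  refine absurd (hle.trans degree_map_le) (not_le.2 ?_)
  rwa [degree_C_mul hc, degree_map_eq_of_injective P.subtype_injective] at hgd

/-- The value group of `P` has rank at most one. -/
def IsArchimedean (P : ValuationSubring K) : Prop :=
  ∀ a b : K, P.valuation a < 1 → b ≠ 0 → ∃ n : ℕ, P.valuation (a ^ n) < P.valuation b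

/-- The value of an integral `x` at a place where `y` vanishes is obtained from a norm, after `x` is
modified so that all its other conjugates become units there. The element of `K` so found serves all
places of the set at once, so the set has at most one element. -/
theorem exists_valuation_eq_of_split [CharP L p] [IsGalois K L] [FiniteDimensional K L]
    (hP : IsArchimedean P)
    (hy : y ^ p - y = algebraMap K L u) (hgen : K⟮y⟯ = ⊤)
    (hu : P.valuation u < 1) {z : L} (hz : z ≠ 0) :
    ∃ c : K, ∀ Q ∈ {Q ∈ placesOver L P | Q.valuation y < 1},
      Q.valuation z = Q.valuation (algebraMap K L c) := by
  classical
  obtain ⟨g, rfl⟩ := exists_aeval_eq hy hgen z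
  have hg : g ≠ 0 := fun h => hz (by rw [h, map_zero])
  obtain ⟨c, h, hc, rfl, -⟩ := exists_eq_C_mul_map P hg
  rw [map_mul, aeval_C] at hz ⊢
  set x := aeval y (h.map P.subtype) with hx
  have hx0 : x ≠ 0 := right_ne_zero_of_mul hz
  obtain ⟨n, hn⟩ := hP u (Algebra.norm K x) hu (Algebra.norm_ne_zero_iff.2 hx0)
  -- At `Q` the factor `1 - y ^ (p - 1)` is a unit and `y ^ n` is smaller than `x`, so `w` has the
  -- value of `x`. For `σ ≠ 1` the element `σ y` is a unit and `σ` of that factor is `-u / σ y`,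
  -- hence small; the term `σ (y ^ n)` then makes `σ w` a unit.
  set w := x * (1 - y ^ (p - 1)) + y ^ n with hw
  refine ⟨c * Algebra.norm K w, fun Q ⟨hQ, hyQ⟩ => ?_⟩
  suffices hv : Q.valuation (algebraMap K L (Algebra.norm K w)) = Q.valuation x by
    rw [map_mul, map_mul, map_mul, hv]
  set v := Q.valuation
  obtain ⟨φ, hφ, hσ⟩ := exists_hom_gal hy hgen
  have hvu : v (algebraMap K L u) < 1 := (valuation_algebraMap_lt_one_iff hQ).2 hu
  have hye : y * (1 - y ^ (p - 1)) = -algebraMap K L u := by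
    rw [mul_sub, ← pow_succ', Nat.sub_add_cancel hp.out.one_le, ← hy]; ring
  have hmem (σ : L ≃ₐ[K] L) : v (σ x) ≤ 1 := by
    rw [hx, ← aeval_algHom_apply σ, Q.valuation_le_one_iff]
    refine aeval_map_mem hQ (mem_of_pow_sub_self (p := p) (u := u) ?_ ?_ hQ) h
    · rw [← map_pow, ← map_sub, hy, σ.commutes]
    · exact (P.valuation_le_one_iff u).1 hu.le
  have hone : v (1 - y ^ (p - 1)) = 1 := by
    rw [Valuation.map_sub_eq_of_lt_left, map_one]
    rw [map_one, map_pow]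
    exact pow_lt_one₀ zero_le hyQ (Nat.sub_ne_zero_of_lt hp.out.one_lt)
  have hvy : v y = v (algebraMap K L u) := by
    rw [← Valuation.map_neg v (algebraMap K L u), ← hye, map_mul, hone, mul_one]
  -- The exponent `n` was chosen against the norm of `x`, an element of `K`. Since all conjugates of
  -- `x` are integral, this bounds `y ^ n` by `x` itself.
  have hnorm : v (algebraMap K L (Algebra.norm K x)) ≤ v x := by
    rw [Algebra.norm_eq_prod_automorphisms, ← Finset.mul_prod_erase _ _ (Finset.mem_univ 1),
      map_mul]
    refine mul_le_of_le_one_right' ?_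
    rw [Q.valuation_le_one_iff]
    exact prod_mem fun σ _ => (Q.valuation_le_one_iff _).1 (hmem σ)
  have hyn : v (y ^ n) < v x := by
    refine lt_of_lt_of_le ?_ hnorm
    rw [map_pow, hvy, ← map_pow, ← map_pow]
    exact (valuation_algebraMap_lt_iff hQ).2 hn
  rw [Algebra.norm_eq_prod_automorphisms, map_prod, Finset.prod_eq_single 1]
  · rw [AlgEquiv.one_apply, hw, Valuation.map_add_eq_of_lt_left, map_mul, hone, mul_one]
    rwa [map_mul, hone, mul_one]
  · intro σ _ hσ1
    have hvσ : v (σ y) = 1 := by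
      have h1 : v (ZMod.castHom (dvd_refl p) L (φ σ).toAdd) = 1 := by
        refine valuation_castHom v fun h0 => hσ1 (hφ ?_)
        rw [map_one]; exact h0
      rw [hσ, Valuation.map_add_eq_of_lt_right, h1]
      rwa [h1]
    have hve : v (σ (1 - y ^ (p - 1))) < 1 := by
      have := congrArg (fun t => v (σ t)) hye
      simp only [map_mul, map_neg, σ.commutes, hvσ, one_mul, Valuation.map_neg] at this
      rwa [this]
    have h2 : v (σ (y ^ n)) = 1 := by rw [map_pow, map_pow, hvσ, one_pow]
    rw [hw, map_add, Valuation.map_add_eq_of_lt_right, h2]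
    rw [h2, map_mul, map_mul]
    exact lt_of_le_of_lt (mul_le_of_le_one_left' (hmem σ)) hve
  · simp

end

/-! ### Decomposition of a place in an Artin–Schreier extension. -/

section

variable {p : ℕ} [hp : Fact p.Prime] {K L : Type*} [Field K] [Field L] [Algebra K L]
  {P : ValuationSubring K} {y : L} {u : K}

/-- The residue of `y` is fixed by Frobenius, hence lies in the prime field. -/
theorem exists_valuation_sub_castHom_lt_one [CharP L p] {Q : ValuationSubring L} (hyQ : y ∈ Q)
    (hy : Q.valuation (y ^ p - y) < 1) :
    ∃ c : ZMod p, Q.valuation (y - ZMod.castHom (dvd_refl p) L c) < 1 := by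
  have := charP_residueField (p := p) Q
  have hQ (x : Q) : IsLocalRing.residue Q x = 0 ↔ Q.valuation (x : L) < 1 := by
    rw [IsLocalRing.residue_eq_zero_iff, Q.valuation_lt_one_iff]
  have hw : IsLocalRing.residue Q ⟨y, hyQ⟩ ^ p = IsLocalRing.residue Q ⟨y, hyQ⟩ := by
    rw [← sub_eq_zero, ← map_pow, ← map_sub, hQ]
    exact hy
  obtain ⟨c, hc⟩ := exists_castHom_eq_of_pow_eq_self hw
  refine ⟨c, ?_⟩
  have : CharP Q p := 
    (CharP.charP_iff_prime_eq_zero hp.out).2 (Subtype.ext (by simp))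
  rw [show ZMod.castHom (dvd_refl p) L c = Q.subtype (ZMod.castHom (dvd_refl p) Q c) from
    (RingHom.congr_fun (RingHom.ext_zmod (Q.subtype.comp (ZMod.castHom (dvd_refl p) Q)) _) c).symm]
  refine (hQ (⟨y, hyQ⟩ - ZMod.castHom (dvd_refl p) Q c)).1 ?_
  rw [map_sub, ← hc, sub_eq_zero]
  exact (RingHom.congr_fun (RingHom.ext_zmod
    ((IsLocalRing.residue Q).comp (ZMod.castHom (dvd_refl p) Q)) _) c).symm

theorem adjoin_sub_eq_top (hgen : K⟮y⟯ = ⊤) (a : K) : K⟮y - algebraMap K L a⟯ = ⊤ := by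
  rw [← top_le_iff, ← hgen, adjoin_simple_le_iff]
  have h := add_mem (mem_adjoin_simple_self K (y - algebraMap K L a))
    (K⟮y - algebraMap K L a⟯.algebraMap_mem a)
  rwa [sub_add_cancel] at h

theorem sub_algebraMap_pow_sub [CharP L p] (hy : y ^ p - y = algebraMap K L u) (a : K) :
    (y - algebraMap K L a) ^ p - (y - algebraMap K L a) =
      algebraMap K L (u - (a ^ p - a)) := by
  rw [sub_pow_sub_sub, hy]; simp

theorem algebraMap_castHom {p : ℕ} {K L : Type*} [Field K] [Field L] [Algebra K L]
    [CharP K p] [CharP L p] (c : ZMod p) :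
    algebraMap K L (ZMod.castHom (dvd_refl p) K c) = ZMod.castHom (dvd_refl p) L c :=
  RingHom.congr_fun (RingHom.ext_zmod ((algebraMap K L).comp (ZMod.castHom (dvd_refl p) K)) _) c

/-- The places over `P` at which `y` has residue `c`. -/
def placesWithResidue (L : Type*) [Field L] [Algebra K L] [CharP L p] (P : ValuationSubring K)
    (y : L) (c : ZMod p) : Set (ValuationSubring L) :=
  {Q ∈ placesOver L P | Q.valuation (y - ZMod.castHom (dvd_refl p) L c) < 1}

theorem exists_valuation_eq_of_placesWithResidue [CharP K p] [CharP L p] [IsGalois K L]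
    [FiniteDimensional K L]
    (hP : IsArchimedean P)
    (hy : y ^ p - y = algebraMap K L u) (hgen : K⟮y⟯ = ⊤) (hu : P.valuation u < 1)
    (c : ZMod p) {z : L} (hz : z ≠ 0) :
    ∃ a : K, ∀ Q ∈ placesWithResidue L P y c,
      Q.valuation z = Q.valuation (algebraMap K L a) := by
  have h1 := sub_algebraMap_pow_sub hy (ZMod.castHom (dvd_refl p) K c)
  rw [castHom_pow, sub_self, sub_zero] at h1
  have h := exists_valuation_eq_of_split hP h1 (adjoin_sub_eq_top hgen _) hu hz
  rwa [algebraMap_castHom] at h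

theorem exists_mem_placesWithResidue [CharP L p] (hy : y ^ p - y = algebraMap K L u)
    (hu : P.valuation u < 1) {Q : ValuationSubring L} (hQ : Q ∈ placesOver L P) :
    ∃ c : ZMod p, Q ∈ placesWithResidue L P y c := by
  obtain ⟨c, hc⟩ := exists_valuation_sub_castHom_lt_one (p := p) (y := y) (Q := Q)
    (mem_of_pow_sub_self hy ((P.valuation_le_one_iff u).1 hu.le) hQ)
    (by rw [hy]; exact (valuation_algebraMap_lt_one_iff hQ).2 hu)
  exact ⟨c, hQ, hc⟩

theorem isUnramified_of_split [CharP K p] [CharP L p] [IsGalois K L]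
    [FiniteDimensional K L]
    (hP : IsArchimedean P)
    (hy : y ^ p - y = algebraMap K L u) (hgen : K⟮y⟯ = ⊤) (hu : P.valuation u < 1) :
    IsUnramified L P := by
  intro Q hQ
  obtain ⟨c, hc⟩ := exists_mem_placesWithResidue hy hu hQ
  rw [ramificationIndex_eq_one_iff]
  intro z hz
  obtain ⟨a, ha⟩ := exists_valuation_eq_of_placesWithResidue hP hy hgen hu c hz
  exact ⟨a, ha Q hc⟩

/-- The residue of `y` gives a bijection from the places above `P` to `𝔽_p`: each fibre has at most
one place, and the Galois group translates the residues transitively. -/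
theorem ncard_placesOver_of_split [CharP K p] [CharP L p] [IsGalois K L]
    [FiniteDimensional K L]
    (hP : IsArchimedean P)
    (hy : y ^ p - y = algebraMap K L u) (hgen : K⟮y⟯ = ⊤) (hu : P.valuation u < 1)
    (hd : Module.finrank K L = p) : (placesOver L P).ncard = p := by
  choose f hf using fun Q : placesOver L P => exists_mem_placesWithResidue hy hu Q.2
  suffices hb : Function.Bijective f by
    rw [← Nat.card_coe_set_eq, Nat.card_eq_of_bijective f hb, Nat.card_zmod]
  constructor
  · intro Q Q' h
    refine Subtype.ext (eq_of_forall_exists_valuation_eq (P := P)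
      (S := placesWithResidue L P y (f Q)) (fun _ h => h.1) (fun z hz => ?_) (hf Q) ?_)
    · exact exists_valuation_eq_of_placesWithResidue hP hy hgen hu _ hz
    · rw [h]; exact hf Q'
  · intro c
    obtain ⟨Q₀, hQ₀⟩ := exists_mem_placesOver (L := L) P
    obtain ⟨c₀, hc₀⟩ := exists_mem_placesWithResidue hy hu hQ₀
    obtain ⟨φ, hφ, hσ⟩ := exists_hom_gal hy hgen
    have hφb : Function.Bijective φ := by
      have : Finite (L ≃ₐ[K] L) := inferInstance
      refine (Nat.bijective_iff_injective_and_card φ).2 ⟨hφ, ?_⟩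
      rw [IsGalois.card_aut_eq_finrank, hd, Nat.card_congr Multiplicative.toAdd, Nat.card_zmod]
    -- This `σ` sends `y` to `y + c - c₀`, so pulling back `Q₀` along it changes the residue of `y`
    -- from `c₀` to `c`.
    obtain ⟨σ, hσc⟩ := hφb.2 (Multiplicative.ofAdd (c - c₀))
    let Q := Q₀.comap (σ : L →+* L)
    have hQ : Q ∈ placesOver L P := by
      refine ValuationSubring.ext _ _ fun x => ?_
      change σ (algebraMap K L x) ∈ Q₀ ↔ _
      rw [σ.commutes, algebraMap_mem_iff hQ₀]
    have hlt {x : L} (hx : Q₀.valuation (σ x) < 1) : Q.valuation x < 1 := by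
      rw [← ValuationSubring.mem_nonunits_iff, ValuationSubring.mem_nonunits_iff_or] at hx ⊢
      refine hx.imp (fun h => by simpa using h) fun h h' => h ?_
      rw [← map_inv₀]
      exact h'
    have hres : Q.valuation (y - ZMod.castHom (dvd_refl p) L c) < 1 := by
      apply hlt
      rw [← algebraMap_castHom (K := K), map_sub, σ.commutes, algebraMap_castHom, hσ, hσc,
        toAdd_ofAdd, map_sub (ZMod.castHom (dvd_refl p) L),
        show y + (ZMod.castHom (dvd_refl p) L c -
          ZMod.castHom (dvd_refl p) L c₀) - ZMod.castHom (dvd_refl p) L c =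
          y - ZMod.castHom (dvd_refl p) L c₀ by ring]
      exact hc₀.2
    refine ⟨⟨Q, hQ⟩, ?_⟩
    by_contra hne
    have h1 := valuation_castHom (E := L) Q.valuation (sub_ne_zero.2 hne)
    have h2 := Q.valuation.map_sub_lt hres (hf ⟨Q, hQ⟩).2
    rw [sub_sub_sub_cancel_left, ← map_sub, h1] at h2
    exact lt_irrefl _ h2

/-- If `℘(x) = u` has a solution modulo `P`, translating `y` by a lift reduces to the split case;
otherwise the inert case applies. -/
theorem isUnramified_of_mem [CharP K p] [IsGalois K L] [FiniteDimensional K L]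
    (hP : IsArchimedean P)
    (hy : y ^ p - y = algebraMap K L u) (hgen : K⟮y⟯ = ⊤) (hu : u ∈ P) : IsUnramified L P := by
  have : CharP L p := charP_of_injective_algebraMap (algebraMap K L).injective p
  by_cases h : ∃ z ∈ P, P.valuation (z ^ p - z - u) < 1
  · obtain ⟨a, -, ha⟩ := h
    refine isUnramified_of_split hP (sub_algebraMap_pow_sub hy a) (adjoin_sub_eq_top hgen a) ?_
    rwa [Valuation.map_sub_swap]
  · push Not at h
    intro Q hQ
    rw [ramificationIndex_eq_one_iff]
    intro z hz
    obtain ⟨a, ha⟩ := exists_valuation_eq_of_inert hy hgen hu (fun z hz => not_lt.2 (h z hz)) hz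
    exact ⟨a, ha Q hQ⟩

theorem ncard_placesOver_of_inert [CharP K p]
    (hy : y ^ p - y = algebraMap K L u) (hgen : K⟮y⟯ = ⊤) (hu : u ∈ P)
    (hinert : ∀ z ∈ P, ¬ P.valuation (z ^ p - z - u) < 1) : (placesOver L P).ncard ≤ 1 := by
  have hsub : (placesOver L P).Subsingleton := by
    intro Q hQ Q' hQ'
    refine eq_of_forall_exists_valuation_eq (S := placesOver L P) subset_rfl (fun z hz => ?_) hQ hQ'
    exact exists_valuation_eq_of_inert hy hgen hu hinert hz
  have := hsub.finite
  exact (Set.ncard_le_one this).2 fun _ h _ h' => hsub h h'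

/-- At a place above the pole, `y ^ p` dominates `y`, so `v(u) = v(y) ^ p`. Ramification index `1`
would make `v(y)` a value of `K`, and the pole order `n` of `u` a multiple of `p`. -/
theorem not_isUnramified {v : Valuation K (WithZero (Multiplicative ℤ))} {n : ℕ}
    (hy : y ^ p - y = algebraMap K L u) (hu : v u = WithZero.exp (n : ℤ)) (hn : ¬ p ∣ n) :
    ¬ IsUnramified L v.valuationSubring := by
  intro h
  obtain ⟨Q, hQ⟩ := exists_mem_placesOver (L := L) v.valuationSubring
  have hequiv := (v.isEquiv_valuation_valuationSubring.trans (isEquiv_comap hQ).symm)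
  have hn0 : n ≠ 0 := fun h => hn (h ▸ dvd_zero p)
  have h1 : 1 < v u := by
    rw [hu, ← WithZero.exp_zero, WithZero.exp_lt_exp]
    omega
  have h2 : 1 < Q.valuation (y ^ p - y) := by
    rw [hy]
    exact hequiv.one_lt_iff_one_lt.1 h1
  have hy1 := one_lt_valuation_of_pow_sub_self _ h2
  have hy0 : y ≠ 0 := by
    rintro rfl
    simp at hy1
  obtain ⟨c, hc⟩ := ramificationIndex_eq_one_iff.1 (h Q hQ) y hy0
  have h3 := valuation_pow_sub_self (p := p) _ hy1
  rw [hy, hc, ← map_pow, ← map_pow] at h3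
  have h4 : v u = v (c ^ p) := hequiv.eq_iff.2 h3
  have hc0 : v c ≠ 0 := by
    intro h0
    rw [h4, map_pow, h0, zero_pow hp.out.ne_zero] at h1
    simp at h1
  rw [hu, map_pow, ← WithZero.exp_log hc0, ← WithZero.exp_nsmul, WithZero.exp_inj] at h4
  apply hn
  exact Int.natCast_dvd_natCast.1 ⟨_, by simpa using h4⟩

end

/-! ### Valuations with integer values: rank one and maximality. -/

section

variable {K : Type*} [Field K]

theorem isArchimedean_valuationSubring (v : Valuation K (WithZero (Multiplicative ℤ))) :
    IsArchimedean v.valuationSubring := by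
  intro a b ha hb
  have h := v.isEquiv_valuation_valuationSubring
  rw [← h.lt_one_iff_lt_one] at ha
  obtain ⟨n, hn⟩ := exists_pow_lt₀ ha (Units.mk0 (v b) (by simpa using hb))
  exact ⟨n, h.lt_iff_lt.1 (by rwa [map_pow])⟩

/-- A discrete valuation ring is a maximal proper subring: given one element `x` with `v x > 1`,
every `z` is an integral element times a power of `x`. -/
theorem eq_of_valuationSubring_le {v : Valuation K (WithZero (Multiplicative ℤ))}
    {P : ValuationSubring K} (hle : v.valuationSubring ≤ P) (hP : P ≠ ⊤) :
    v.valuationSubring = P := by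
  refine le_antisymm hle fun x hx => ?_
  by_contra hxv
  rw [v.mem_valuationSubring_iff, not_le] at hxv
  have hx0 : x ≠ 0 := by
    rintro rfl
    simp at hxv
  refine hP (top_le_iff.1 fun z _ => ?_)
  rcases eq_or_ne z 0 with rfl | hz
  · exact P.zero_mem
  obtain ⟨n, hn⟩ := exists_pow_lt₀ (a := v x⁻¹) (by
    rw [map_inv₀]; exact inv_lt_one_of_one_lt₀ hxv) (Units.mk0 (v z)⁻¹ (by simpa using hz))
  have h1 : z * x⁻¹ ^ n ∈ P := by
    refine hle ?_
    rw [v.mem_valuationSubring_iff, map_mul, map_pow]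
    have := mul_le_mul_right hn.le (v z)
    rwa [Units.val_mk0, mul_inv_cancel₀ (by simpa using hz)] at this
  have h2 := P.mul_mem _ _ h1 (pow_mem hx n)
  rwa [mul_assoc, ← mul_pow, inv_mul_cancel₀ hx0, one_pow, mul_one] at h2

end

/-! ### The places of `F(t)` and the values of polynomials in `1/t`. -/

section RationalFunctionField

variable {F : Type*} [Field F]

instance isTrivialOn_valuation [Finite F] (P : ValuationSubring (RatFunc F)) :
    P.valuation.IsTrivialOn F := by
  refine ⟨fun a ha => ?_⟩
  have := Fintype.ofFinite F
  have h := congrArg (fun x => P.valuation (algebraMap F (RatFunc F) x))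
    (FiniteField.pow_card_sub_one_eq_one a ha)
  simp only [map_pow, map_one] at h
  exact (pow_eq_one_iff_of_nonneg zero_le
    (Nat.sub_ne_zero_of_lt Fintype.one_lt_card)).1 h

/-- If `t` is not integral at `P`, the place is infinity. Otherwise `F[t] ⊆ P`, the maximal ideal of
`P` meets `F[t]` in a nonzero prime, and `P` contains the corresponding discrete valuation ring,
which is maximal. -/
theorem exists_heightOneSpectrum_or_eq_inftyPlace [Finite F] {P : ValuationSubring (RatFunc F)}
    (hP : P ≠ ⊤) :
    (∃ w : IsDedekindDomain.HeightOneSpectrum F[X],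
      P = (w.valuation (RatFunc F)).valuationSubring) ∨ P = inftyPlace F := by
  classical
  rcases lt_or_ge 1 (P.valuation RatFunc.X) with h | h
  · right
    have := RatFunc.valuation_isEquiv_inftyValuation_of_one_lt_valuation_X h
    rw [Valuation.isEquiv_iff_valuationSubring, P.valuationSubring_valuation] at this
    rw [this, inftyPlace]
  · left
    have hnt : P.valuation.IsNontrivial := by
      by_contra h'
      exact hP (P.eq_top_iff.2 h')
    have hpoly (g : F[X]) : P.valuation (algebraMap F[X] (RatFunc F) g) ≤ 1 :=
      Polynomial.valuation_le_one_of_valuation_X_le_one _ h g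
    obtain ⟨g, hg1, hg0⟩ :=
      RatFunc.setOfPred_polynomial_valuation_lt_one_and_ne_zero_nonempty h
    let ι : F[X] →+* P := (algebraMap F[X] (RatFunc F)).codRestrict P.toSubring
      fun g => (P.valuation_le_one_iff _).1 (hpoly g)
    have hι (g : F[X]) : g ∈ (IsLocalRing.maximalIdeal P).comap ι ↔
        P.valuation (algebraMap F[X] (RatFunc F) g) < 1 := by
      rw [Ideal.mem_comap, P.valuation_lt_one_iff]; rfl
    let w : IsDedekindDomain.HeightOneSpectrum F[X] :=
      { asIdeal := (IsLocalRing.maximalIdeal P).comap ι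
        isPrime := inferInstance
        ne_bot := fun hb => hg0 (by
          have : g ∈ (IsLocalRing.maximalIdeal P).comap ι := (hι g).2 hg1
          rwa [hb] at this) }
    refine ⟨w, (eq_of_valuationSubring_le (fun x hx => ?_) hP).symm⟩
    obtain ⟨n, d, hnd⟩ := w.exists_primeCompl_mul_eq_of_integer x hx
    have hd : P.valuation (algebraMap F[X] (RatFunc F) d) = 1 :=
      le_antisymm (hpoly d) (not_lt.1 fun hlt => d.2 ((hι d).2 hlt))
    have hx' := hpoly n
    rw [← hnd, map_mul, hd, mul_one] at hx'
    exact (P.valuation_le_one_iff x).1 hx'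

theorem isArchimedean_of_ne_top [Finite F] {P : ValuationSubring (RatFunc F)}
    (hP : P ≠ ⊤) : IsArchimedean P := by
  obtain ⟨w, rfl⟩ | rfl := exists_heightOneSpectrum_or_eq_inftyPlace hP
  · exact isArchimedean_valuationSubring _
  · exact isArchimedean_valuationSubring _

theorem evalInv_mem [Finite F] {P : ValuationSubring (RatFunc F)}
    (hP : (RatFunc.X : RatFunc F)⁻¹ ∈ P) (W : F[X]) : evalInv W ∈ P := by
  have hC (a : F) : algebraMap F (RatFunc F) a ∈ P := by
    rw [← P.valuation_le_one_iff]
    rcases eq_or_ne a 0 with rfl | ha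
    · simp
    · exact (Valuation.IsTrivialOn.eq_one (v := P.valuation) a ha).le
  rw [evalInv, aeval_eq_sum_range]
  refine sum_mem fun i _ => ?_
  rw [Algebra.smul_def]
  exact mul_mem (hC _) (pow_mem hP i)

theorem inv_X_mem [Finite F] {P : ValuationSubring (RatFunc F)} (hP : P ≠ ⊤)
    (hP0 : P ≠ zeroPlace F) : (RatFunc.X : RatFunc F)⁻¹ ∈ P := by
  classical
  obtain ⟨w, rfl⟩ | rfl := exists_heightOneSpectrum_or_eq_inftyPlace hP
  · rw [Valuation.mem_valuationSubring_iff, map_inv₀]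
    have hX : (X : F[X]) ∉ w.asIdeal := by
      intro h
      apply hP0
      have : w = idealX F := by
        apply IsDedekindDomain.HeightOneSpectrum.ext
        have hle : (idealX F).asIdeal ≤ w.asIdeal := by
          rwa [idealX_span, Ideal.span_singleton_le_iff_mem]
        exact ((idealX F).isMaximal.eq_of_le w.isPrime.ne_top hle).symm
      rw [this, zeroPlace]
    rw [← RatFunc.algebraMap_X, w.valuation_eq_one_iff_notMem.2 hX, inv_one]
  · rw [inftyPlace, Valuation.mem_valuationSubring_iff, map_inv₀, RatFunc.inftyValuation.X,
      ← WithZero.exp_neg, ← WithZero.exp_zero, WithZero.exp_le_exp]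
    norm_num

theorem inftyPlace_ne_top : inftyPlace F ≠ ⊤ := by
  classical
  rw [inftyPlace, ne_eq, Valuation.valuationSubring_eq_top_iff, not_not]
  infer_instance

theorem valuationSubring_ne_top (w : IsDedekindDomain.HeightOneSpectrum F[X]) :
    (w.valuation (RatFunc F)).valuationSubring ≠ ⊤ := by
  rw [ne_eq, Valuation.valuationSubring_eq_top_iff, not_not]
  infer_instance

theorem inv_X_notMem_zeroPlace : (RatFunc.X : RatFunc F)⁻¹ ∉ zeroPlace F := by
  rw [zeroPlace, Valuation.mem_valuationSubring_iff, map_inv₀, valuation_X_eq_neg_one,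
    ← WithZero.exp_neg, ← WithZero.exp_zero, WithZero.exp_le_exp]
  norm_num

theorem valuation_inv_X_inftyPlace_lt_one :
    (inftyPlace F).valuation (RatFunc.X : RatFunc F)⁻¹ < 1 := by
  classical
  rw [inftyPlace, ← (Valuation.isEquiv_valuation_valuationSubring _).lt_one_iff_lt_one, map_inv₀,
    RatFunc.inftyValuation.X, ← WithZero.exp_neg, ← WithZero.exp_zero, WithZero.exp_lt_exp]
  norm_num

theorem inftyPlace_ne_zeroPlace : inftyPlace F ≠ zeroPlace F := by
  intro h
  apply inv_X_notMem_zeroPlace (F := F)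
  rw [← h, ← ValuationSubring.valuation_le_one_iff]
  exact valuation_inv_X_inftyPlace_lt_one.le

/-- What remains of `W(1/t)` without its constant term is divisible by `1/t`, a nonunit at infinity.
-/
theorem valuation_evalInv_sub_C_lt_one [Finite F] (W : F[X]) :
    (inftyPlace F).valuation (evalInv W - algebraMap F (RatFunc F) (W.coeff 0)) < 1 := by
  have h : evalInv W - algebraMap F (RatFunc F) (W.coeff 0) = evalInv W.divX * RatFunc.X⁻¹ := by
    conv_lhs => rw [← divX_mul_X_add W]
    simp [evalInv]
  rw [h, map_mul]
  have hm := evalInv_mem (P := inftyPlace F)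
    ((ValuationSubring.valuation_le_one_iff _ _).1 valuation_inv_X_inftyPlace_lt_one.le) W.divX
  refine lt_of_le_of_lt (mul_le_of_le_one_left' ?_) valuation_inv_X_inftyPlace_lt_one
  rwa [ValuationSubring.valuation_le_one_iff]

/-- The residue field at infinity is the field of constants. -/
theorem exists_valuation_sub_C_lt_one {z : RatFunc F} (hz : z ∈ inftyPlace F) :
    ∃ a : F, (inftyPlace F).valuation (z - algebraMap F (RatFunc F) a) < 1 := by
  classical
  have hequiv := (RatFunc.inftyValuation F).isEquiv_valuation_valuationSubring
  rw [inftyPlace, Valuation.mem_valuationSubring_iff] at hz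
  have hinfty {g : F[X]} (hg : g ≠ 0) : RatFunc.inftyValuation F (algebraMap F[X] (RatFunc F) g) =
      WithZero.exp (g.natDegree : ℤ) := RatFunc.inftyValuation.polynomial F hg
  have hd0 := z.denom_ne_zero
  have hnd : z.num.natDegree ≤ z.denom.natDegree := by
    rcases eq_or_ne z.num 0 with h0 | h0
    · rw [h0, natDegree_zero]; exact Nat.zero_le _
    rw [← z.num_div_denom, map_div₀, hinfty h0, hinfty hd0, ← WithZero.exp_sub,
      ← WithZero.exp_zero, WithZero.exp_le_exp] at hz
    omega
  -- The denominator is monic, so subtracting `a` cancels the coefficient of the numerator in the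
  -- degree of the denominator; `a = 0` if the numerator has smaller degree.
  set a := z.num.coeff z.denom.natDegree with ha
  refine ⟨a, ?_⟩
  rw [inftyPlace, ← hequiv.lt_one_iff_lt_one]
  have hz' : z - algebraMap F (RatFunc F) a =
      algebraMap F[X] (RatFunc F) (z.num - C a * z.denom) / algebraMap _ _ z.denom := by
    rw [eq_div_iff (RatFunc.algebraMap_ne_zero hd0), sub_mul, map_sub, map_mul,
      ← (eq_div_iff (RatFunc.algebraMap_ne_zero hd0)).1 z.num_div_denom.symm]
    rfl
  rw [hz']
  rcases eq_or_ne (z.num - C a * z.denom) 0 with h0 | h0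
  · rw [h0]; simp
  rw [map_div₀, hinfty h0, hinfty hd0, ← WithZero.exp_sub, ← WithZero.exp_zero,
    WithZero.exp_lt_exp]
  suffices (z.num - C a * z.denom).natDegree < z.denom.natDegree by omega
  have hle : (z.num - C a * z.denom).natDegree ≤ z.denom.natDegree :=
    (natDegree_sub_le _ _).trans (max_le hnd (natDegree_C_mul_le _ _))
  refine lt_of_le_of_ne hle fun heq => h0 (leadingCoeff_eq_zero.1 ?_)
  rw [leadingCoeff, heq, coeff_sub, coeff_C_mul, z.monic_denom.coeff_natDegree, mul_one, ha,
    sub_self]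

theorem one_lt_valuation_inv_X :
    1 < (idealX F).valuation (RatFunc F) (RatFunc.X : RatFunc F)⁻¹ := by
  have := inv_X_notMem_zeroPlace (F := F)
  rwa [zeroPlace, Valuation.mem_valuationSubring_iff, not_le] at this

instance isTrivialOn_heightOneSpectrum (w : IsDedekindDomain.HeightOneSpectrum F[X]) :
    (w.valuation (RatFunc F)).IsTrivialOn F := by
  refine ⟨fun a ha => ?_⟩
  rw [IsScalarTower.algebraMap_apply F F[X] (RatFunc F), w.valuation_eq_one_iff_notMem]
  intro h
  exact w.isPrime.ne_top (Ideal.eq_top_of_isUnit_mem _ h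
    ((isUnit_iff_ne_zero.2 ha).map (algebraMap F F[X])))

theorem valuation_evalInv {W : F[X]} (hW : W ≠ 0) :
    (idealX F).valuation (RatFunc F) (evalInv W) = WithZero.exp (W.natDegree : ℤ) := by
  rw [evalInv, Polynomial.valuation_aeval_eq_valuation_X_pow_natDegree_of_one_lt_valuation_X _
    one_lt_valuation_inv_X hW, map_inv₀, valuation_X_eq_neg_one, ← WithZero.exp_neg,
    ← WithZero.exp_nsmul]
  simp

/-- A reduced polynomial in `1/t` that is of the form `z ^ p - z` is constant. -/
theorem natDegree_eq_zero_of_evalInv_eq {p : ℕ} [hp : Fact p.Prime] {W : F[X]}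
    (hW : IsReduced p W) {z : RatFunc F} (hz : z ^ p - z = evalInv W) : W.natDegree = 0 := by
  by_contra h0
  have hW0 : W ≠ 0 := fun h => h0 (by rw [h, natDegree_zero])
  have hdvd : ¬ p ∣ W.natDegree := fun h =>
    hW0 (leadingCoeff_eq_zero.1 (hW _ (Nat.pos_of_ne_zero h0) h))
  have h1 : 1 < (idealX F).valuation (RatFunc F) (z ^ p - z) := by
    rw [hz, valuation_evalInv hW0, ← WithZero.exp_zero, WithZero.exp_lt_exp]
    omega
  have hz1 := one_lt_valuation_of_pow_sub_self _ h1
  -- The pole of `z ^ p - z` at `t = 0` has order `p` times that of `z`, whereas `W(1/t)` has a pole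
  -- of order `W.natDegree`, prime to `p`.
  have h2 := valuation_pow_sub_self (p := p) _ hz1
  rw [hz, valuation_evalInv hW0, ← WithZero.exp_log (zero_lt_one.trans hz1).ne',
    ← WithZero.exp_nsmul, WithZero.exp_inj] at h2
  exact hdvd (Int.natCast_dvd_natCast.1 ⟨_, by simpa using h2⟩)

end RationalFunctionField

/-! ### Normal forms modulo `z ^ p - z`. -/

section Reduction

variable {p : ℕ} {F : Type*} [Field F]

theorem IsReduced.add {W W' : F[X]} (h : IsReduced p W) (h' : IsReduced p W') :
    IsReduced p (W + W') := fun i hi hpi => by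
  rw [coeff_add, h i hi hpi, h' i hi hpi, add_zero]

theorem IsReduced.add_C {W : F[X]} (h : IsReduced p W) (a : F) :
    IsReduced p (W + C a) := fun i hi hpi => by
  rw [coeff_add, h i hi hpi, coeff_C_of_ne_zero hi.ne', add_zero]

variable [hp : Fact p.Prime]

theorem exists_pow_eq (p : ℕ) [hp : Fact p.Prime] {E : Type*} [Field E] [Finite E] [CharP E p]
    (a : E) : ∃ b, b ^ p = a :=
  Finite.surjective_of_injective (frobenius_inj E p) a

theorem exists_isReduced [Finite F] [CharP F p] (W : F[X]) :
    ∃ W' G : F[X], IsReduced p W' ∧ W = W' + (G ^ p - G) := by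
  induction W using Polynomial.induction_on' with
  | add W₁ W₂ h₁ h₂ =>
    obtain ⟨W₁', G₁, hr₁, rfl⟩ := h₁
    obtain ⟨W₂', G₂, hr₂, rfl⟩ := h₂
    refine ⟨W₁' + W₂', G₁ + G₂, hr₁.add hr₂, ?_⟩
    rw [add_pow_char]; ring
  | monomial n a =>
    induction n using Nat.strong_induction_on generalizing a with
    | _ n ih =>
      by_cases hn : 0 < n ∧ p ∣ n
      · obtain ⟨hn0, m, rfl⟩ := hn
        obtain ⟨b, rfl⟩ := exists_pow_eq p a
        have hm : 0 < m := Nat.pos_of_mul_pos_left hn0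
        -- Modulo `℘`, the monomial `b ^ p T ^ (p m)` equals `b T ^ m`, of smaller degree.
        obtain ⟨W', G, hr, h⟩ := ih m (lt_mul_of_one_lt_left hm hp.out.one_lt) b
        refine ⟨W', G + monomial m b, hr, ?_⟩
        rw [mul_comm p m, ← monomial_pow, add_pow_char, ← sub_eq_zero]
        linear_combination h
      · refine ⟨monomial n a, 0, fun i hi hpi => ?_, by simp [hp.out.ne_zero]⟩
        rw [coeff_monomial, if_neg]
        rintro rfl
        exact hn ⟨hi, hpi⟩

/-- Laurent polynomials are sums of a polynomial in `t` and one in `1/t`. -/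
theorem exists_div_X_pow_eq (N : F[X]) (k : ℕ) : ∃ A B : F[X],
    algebraMap F[X] (RatFunc F) N / RatFunc.X ^ k = algebraMap F[X] (RatFunc F) A + evalInv B := by
  induction N using Polynomial.induction_on' with
  | add N₁ N₂ h₁ h₂ =>
    obtain ⟨A₁, B₁, h₁⟩ := h₁
    obtain ⟨A₂, B₂, h₂⟩ := h₂
    refine ⟨A₁ + A₂, B₁ + B₂, ?_⟩
    rw [map_add, add_div, h₁, h₂, map_add, evalInv, evalInv, evalInv, map_add]
    ring
  | monomial n a =>
    have hX : (RatFunc.X : RatFunc F) ≠ 0 := RatFunc.X_ne_zero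
    rw [← C_mul_X_pow_eq_monomial, map_mul, map_pow, RatFunc.algebraMap_X]
    rcases le_total k n with h | h
    · refine ⟨C a * X ^ (n - k), 0, ?_⟩
      obtain ⟨m, rfl⟩ := Nat.exists_eq_add_of_le h
      rw [Nat.add_sub_cancel_left, map_mul, map_pow, RatFunc.algebraMap_X, evalInv, map_zero]
      field_simp
      ring
    · refine ⟨0, C a * X ^ (k - n), ?_⟩
      obtain ⟨m, rfl⟩ := Nat.exists_eq_add_of_le h
      rw [Nat.add_sub_cancel_left, evalInv, map_mul, map_pow, aeval_X, aeval_C, map_zero,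
        show algebraMap F[X] (RatFunc F) (C a) = algebraMap F (RatFunc F) a from
          (IsScalarTower.algebraMap_apply F F[X] (RatFunc F) a).symm, inv_pow]
      field_simp
      ring

/-- The residue field `F[T]/(π)` is finite, hence perfect, so the class of `N / D` is a `p`-th
power. -/
theorem exists_dvd_sub_pow_mul [Finite F] [CharP F p] {π D : F[X]} (hπ : Irreducible π)
    (hD : ¬ π ∣ D) (N : F[X]) : ∃ b, π ∣ N - b ^ p * D := by
  have : Fact (Irreducible π) := ⟨hπ⟩
  have : Module.Finite F (AdjoinRoot π) := (AdjoinRoot.powerBasis hπ.ne_zero).finite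
  have : Finite (AdjoinRoot π) := Module.finite_of_finite F
  have : CharP (AdjoinRoot π) p :=
    charP_of_injective_algebraMap (algebraMap F (AdjoinRoot π)).injective p
  obtain ⟨b, hb⟩ := exists_pow_eq p (AdjoinRoot.mk π N / AdjoinRoot.mk π D)
  obtain ⟨b, rfl⟩ := AdjoinRoot.mk_surjective b
  have hD' : AdjoinRoot.mk π D ≠ 0 := by rwa [ne_eq, AdjoinRoot.mk_eq_zero]
  refine ⟨b, ?_⟩
  rw [← AdjoinRoot.mk_eq_zero, map_sub, map_mul, map_pow, hb, div_mul_cancel₀ _ hD', sub_self]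

/-- Modulo `z ^ p - z`, every rational function has only poles of order prime to `p` at the finite
places. -/
theorem exists_sub_eq_div [Finite F] [CharP F p] (f : RatFunc F) :
    ∃ (g : RatFunc F) (N D : F[X]), D ≠ 0 ∧
      f - (g ^ p - g) = algebraMap F[X] (RatFunc F) N / algebraMap F[X] (RatFunc F) D ∧
      ∀ (π D' : F[X]) (n : ℕ), Irreducible π → D = π ^ n * D' → 0 < n → ¬ π ∣ D' →
        ¬ π ∣ N ∧ ¬ p ∣ n := by
  have : CharP (RatFunc F) p :=
    charP_of_injective_algebraMap (algebraMap F (RatFunc F)).injective p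
  let T (d : ℕ) : Prop := ∃ (g : RatFunc F) (N D : F[X]), D ≠ 0 ∧ D.natDegree = d ∧
    f - (g ^ p - g) = algebraMap F[X] (RatFunc F) N / algebraMap F[X] (RatFunc F) D
  have hT : ∃ d, T d := ⟨_, 0, f.num, f.denom, f.denom_ne_zero, rfl, by
    rw [f.num_div_denom]; simp [hp.out.ne_zero]⟩
  classical
  obtain ⟨g, N, D, hD0, hd, hf⟩ := Nat.find_spec hT
  refine ⟨g, N, D, hD0, hf, fun π D' n hπ hD hn hπD' => ?_⟩
  -- The denominator `D` has least degree among all representatives, so no factor `π` can be removed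
  -- from it.
  have hmin (g' : RatFunc F) (M : F[X])
      (h : f - (g' ^ p - g') = algebraMap F[X] (RatFunc F) M /
        algebraMap F[X] (RatFunc F) (π ^ (n - 1) * D')) : False := by
    have hE0 : π ^ (n - 1) * D' ≠ 0 := by
      refine mul_ne_zero (pow_ne_zero _ hπ.ne_zero) ?_
      rintro rfl
      exact hπD' (dvd_zero _)
    refine Nat.find_min hT ?_ ⟨g', M, π ^ (n - 1) * D', hE0, rfl, h⟩
    rw [← hd, hD, show π ^ n * D' = π * (π ^ (n - 1) * D') by
      rw [← mul_assoc, ← pow_succ', Nat.sub_add_cancel hn], natDegree_mul hπ.ne_zero hE0]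
    have := hπ.natDegree_pos
    omega
  have hπ0 : algebraMap F[X] (RatFunc F) π ≠ 0 := RatFunc.algebraMap_ne_zero hπ.ne_zero
  have hD'0 : algebraMap F[X] (RatFunc F) D' ≠ 0 := by
    refine RatFunc.algebraMap_ne_zero ?_
    rintro rfl
    exact hπD' (dvd_zero _)
  constructor
  · rintro ⟨M, rfl⟩
    refine hmin g M ?_
    obtain ⟨m, rfl⟩ := Nat.exists_eq_add_of_lt hn
    rw [hf, hD]
    simp only [map_mul, map_pow, zero_add, Nat.add_sub_cancel]
    field_simp
    ring
  · rintro ⟨m, rfl⟩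
    obtain ⟨b, M, hM⟩ := exists_dvd_sub_pow_mul (p := p) hπ hπD' N
    have hm : 0 < m := Nat.pos_of_mul_pos_left hn
    have hlt : m < p * m := lt_mul_of_one_lt_left hm hp.out.one_lt
    obtain ⟨l, hl⟩ := Nat.exists_eq_add_of_lt hlt
    -- Subtracting `℘(b / π ^ m)` cancels the leading polar term at `π` and introduces only a pole
    -- of order `m`. Here `l = p m - m - 1`, so `b / π ^ m` becomes `b π ^ l D'` over the new
    -- denominator.
    refine hmin (g + algebraMap _ _ b / algebraMap _ _ π ^ m) (M + b * π ^ l * D') ?_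
    have hN : N = b ^ p * D' + π * M := by rw [← hM]; ring
    rw [add_pow_sub_add, ← sub_sub, hf, hD, hN]
    simp only [map_mul, map_pow, map_add, div_pow]
    rw [← pow_mul, mul_comm m p, hl, Nat.add_sub_cancel]
    field_simp
    ring

theorem valuation_div_eq_exp {π N D : F[X]} {n : ℕ} (w : IsDedekindDomain.HeightOneSpectrum F[X])
    (hw : w.asIdeal = Ideal.span {π}) (hπ : π ≠ 0) (hN : ¬ π ∣ N) (hD : ¬ π ∣ D) :
    w.valuation (RatFunc F) (algebraMap F[X] (RatFunc F) N /
      algebraMap F[X] (RatFunc F) (π ^ n * D)) = WithZero.exp (n : ℤ) := by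
  have hv {g : F[X]} (hg : ¬ π ∣ g) : w.valuation (RatFunc F) (algebraMap _ _ g) = 1 := by
    rw [w.valuation_eq_one_iff_notMem, hw, Ideal.mem_span_singleton]
    exact hg
  rw [map_div₀, map_mul, map_pow, map_mul, map_pow, hv hN, hv hD, w.valuation_of_algebraMap,
    w.intValuation_singleton hπ hw, ← WithZero.exp_nsmul, mul_one, one_div, ← WithZero.exp_neg]
  simp

/-- Every pole of order prime to `p` away from `t = 0` would ramify. After `exists_sub_eq_div` the
denominator is therefore a constant times `t ^ k`; the polynomial part and the part in `1/t` are
then reduced separately, and the former must be constant because infinity is unramified. -/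
theorem exists_isReduced_of_isUnramifiedOutsideZero [Finite F] [CharP F p] {L : Type*} [Field L]
    [Algebra (RatFunc F) L] (hL : IsUnramifiedOutsideZero F L) {y : L} {f : RatFunc F}
    (hy : y ^ p - y = algebraMap (RatFunc F) L f) :
    ∃ (W : F[X]) (g : RatFunc F), IsReduced p W ∧ f - (g ^ p - g) = evalInv W := by
  classical
  have : CharP (RatFunc F) p :=
    charP_of_injective_algebraMap (algebraMap F (RatFunc F)).injective p
  have : CharP L p := charP_of_injective_algebraMap (algebraMap (RatFunc F) L).injective p
  obtain ⟨g, N, D, hD0, hf, hND⟩ := exists_sub_eq_div (p := p) f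
  have hfin {π E : F[X]} (hE : E ≠ 0) (hπ : Irreducible π) :
      ∃ n E', E = π ^ n * E' ∧ ¬ π ∣ E' :=
    (FiniteMultiplicity.of_not_isUnit hπ.not_isUnit hE).exists_eq_pow_mul_and_not_dvd.elim
      fun E' h => ⟨_, E', h⟩
  obtain ⟨k, D', rfl, hXD⟩ := hfin hD0 irreducible_X
  -- An irreducible factor of `D'` is not associated to `X`, so it defines a place other than `t =
  -- 0` at which a pole of order prime to `p` survives.
  have hunit : IsUnit D' := by
    by_contra hu
    obtain ⟨π, hπ, E, rfl⟩ := WfDvdMonoid.exists_irreducible_factor hu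
      (right_ne_zero_of_mul hD0)
    obtain ⟨n, D'', hD, hπD⟩ := hfin hD0 hπ
    have hn : 0 < n := by
      refine Nat.pos_of_ne_zero ?_
      rintro rfl
      rw [pow_zero, one_mul] at hD
      exact hπD (hD ▸ Dvd.intro _ (by ring : π * (X ^ k * E) = _))
    obtain ⟨hπN, hpn⟩ := hND π D'' n hπ hD hn hπD
    have hprime : (Ideal.span {π}).IsPrime :=
      (Ideal.span_singleton_prime hπ.ne_zero).2 hπ.prime
    let w : IsDedekindDomain.HeightOneSpectrum F[X] :=
      ⟨Ideal.span {π}, hprime, by rw [ne_eq, Ideal.span_singleton_eq_bot]; exact hπ.ne_zero⟩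
    refine not_isUnramified (sub_algebraMap_pow_sub hy g)
      (by rw [hf, hD]; exact valuation_div_eq_exp w rfl hπ.ne_zero hπN hπD) hpn
      (hL _ (valuationSubring_ne_top w) fun h => ?_)
    apply inv_X_notMem_zeroPlace (F := F)
    rw [← h, Valuation.mem_valuationSubring_iff, map_inv₀, ← RatFunc.algebraMap_X,
      w.valuation_eq_one_iff_notMem.2, inv_one]
    intro hX
    have hdvd : π ∣ X := Ideal.mem_span_singleton.1 hX
    exact hXD (((hπ.associated_of_dvd irreducible_X hdvd).dvd_iff_dvd_left.1 dvd_rfl).trans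
      (dvd_mul_right _ _))
  obtain ⟨c, hc, rfl⟩ := isUnit_iff.1 hunit
  obtain ⟨A, B, hAB⟩ := exists_div_X_pow_eq (C c⁻¹ * N) k
  obtain ⟨A', G, hA', rfl⟩ := exists_isReduced (p := p) A
  obtain ⟨B', H, hB', rfl⟩ := exists_isReduced (p := p) B
  have hf' : f - (g ^ p - g) = algebraMap F[X] (RatFunc F) (A' + (G ^ p - G)) +
      evalInv (B' + (H ^ p - H)) := by
    rw [hf, ← hAB, map_mul, map_mul, map_pow, RatFunc.algebraMap_X,
      RatFunc.algebraMap_C, RatFunc.algebraMap_C, map_inv₀]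
    have := RatFunc.X_ne_zero (K := F)
    have : RatFunc.C c ≠ 0 := by simpa using hc.ne_zero
    field_simp
  set g' := g + (algebraMap F[X] (RatFunc F) G + evalInv H) with hg'
  have hfg : f - (g' ^ p - g') = algebraMap F[X] (RatFunc F) A' + evalInv B' := by
    rw [hg', add_pow_sub_add, add_pow_sub_add, ← sub_sub, hf']
    simp only [evalInv, map_add, map_sub, map_pow]
    ring
  have hdeg : A'.natDegree = 0 := by
    by_contra h0
    have hA0 : A' ≠ 0 := fun h => h0 (by rw [h, natDegree_zero])
    refine not_isUnramified (n := A'.natDegree) (v := RatFunc.inftyValuation F)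
      (sub_algebraMap_pow_sub hy g') ?_ (fun h =>
      hA0 (leadingCoeff_eq_zero.1 (hA' _ (Nat.pos_of_ne_zero h0) h))) ?_
    · have hA : RatFunc.inftyValuation F (algebraMap F[X] (RatFunc F) A') =
          WithZero.exp (A'.natDegree : ℤ) := RatFunc.inftyValuation.polynomial F hA0
      have hB : RatFunc.inftyValuation F (evalInv B') ≤ 1 := by
        have := evalInv_mem (inv_X_mem inftyPlace_ne_top inftyPlace_ne_zeroPlace) B'
        rwa [inftyPlace, Valuation.mem_valuationSubring_iff] at this
      rw [hfg, Valuation.map_add_eq_of_lt_left, hA]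
      refine lt_of_le_of_lt hB ?_
      rw [hA, ← WithZero.exp_zero, WithZero.exp_lt_exp]
      omega
    · exact hL _ inftyPlace_ne_top inftyPlace_ne_zeroPlace
  -- The constant left over from the polynomial part is absorbed into the constant term, which being
  -- reduced does not restrict.
  refine ⟨B' + C (A'.coeff 0), g', hB'.add_C _, ?_⟩
  rw [hfg, eq_C_of_natDegree_eq_zero hdeg, evalInv, evalInv, map_add, aeval_C, add_comm,
    coeff_C_zero]
  rfl

end Reduction

/-! ### The classes of `γ j / t ^ i` and their span. -/

section Span

variable {p : ℕ} [hp : Fact p.Prime] {F : Type*} [Field F] [Algebra (ZMod p) F] {r : ℕ}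

/-- The reduced polynomials without constant term. -/
def reducedPolynomials (p : ℕ) [Fact p.Prime] (F : Type*) [Field F] [Algebra (ZMod p) F] :
    Submodule (ZMod p) F[X] where
  carrier := {W | IsReduced p W ∧ W.coeff 0 = 0}
  zero_mem' := ⟨fun _ _ _ => coeff_zero _, coeff_zero _⟩
  add_mem' h h' := ⟨h.1.add h'.1, by rw [coeff_add, h.2, h'.2, add_zero]⟩
  smul_mem' c W h := ⟨fun i hi hpi => by rw [coeff_smul, h.1 i hi hpi, smul_zero],
    by rw [coeff_smul, h.2, smul_zero]⟩

/-- The class of `W(1/t)` modulo `z ^ p - z`, as a linear map in `W`. -/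
noncomputable def evalInvClass (p : ℕ) [Fact p.Prime] (F : Type*) [Field F] [Algebra (ZMod p) F] :
    F[X] →ₗ[ZMod p] V p (RatFunc F) :=
  (U p (RatFunc F)).mkQ ∘ₗ
    ((aeval (RatFunc.X : RatFunc F)⁻¹).toLinearMap.restrictScalars (ZMod p))

theorem evalInvClass_apply (W : F[X]) :
    evalInvClass p F W = (U p (RatFunc F)).mkQ (evalInv W) := rfl

/-- The basis `γ j * T ^ i` of the polynomials. -/
noncomputable def polynomialBasis (γ : Module.Basis (Fin r) (ZMod p) F) :
    Module.Basis (Fin r × ℕ) (ZMod p) F[X] :=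
  γ.smulTower (basisMonomials F)

theorem polynomialBasis_apply (γ : Module.Basis (Fin r) (ZMod p) F) (j : Fin r) (i : ℕ) :
    polynomialBasis γ (j, i) = monomial i (γ j) := by
  simp [polynomialBasis, Module.Basis.smulTower_apply, smul_monomial]

theorem S_eq (γ : Module.Basis (Fin r) (ZMod p) F) (x : Fin r × {i : ℕ // 0 < i ∧ ¬ p ∣ i}) :
    S p γ x = evalInvClass p F (polynomialBasis γ (x.1, x.2)) := by
  rw [evalInvClass_apply, polynomialBasis_apply, S, evalInv, aeval_monomial, inv_pow,
    ← div_eq_mul_inv]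
  rfl

theorem span_polynomialBasis (γ : Module.Basis (Fin r) (ZMod p) F) :
    Submodule.span (ZMod p) (Set.range fun x : Fin r × {i : ℕ // 0 < i ∧ ¬ p ∣ i} =>
      polynomialBasis γ (x.1, x.2)) = reducedPolynomials p F := by
  apply le_antisymm
  · rw [Submodule.span_le]
    rintro _ ⟨⟨j, i, hi, hpi⟩, rfl⟩
    simp only [polynomialBasis_apply]
    refine ⟨fun n hn hpn => ?_, coeff_monomial_of_ne _ hi.ne⟩
    exact coeff_monomial_of_ne _ (by rintro rfl; exact hpi hpn)
  · rintro W ⟨hW, hW0⟩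
    rw [as_sum_support W]
    refine Submodule.sum_mem _ fun i hi => ?_
    have hi0 : 0 < i := Nat.pos_of_ne_zero (by rintro rfl; exact mem_support_iff.1 hi hW0)
    have hpi : ¬ p ∣ i := fun h => mem_support_iff.1 hi (hW i hi0 h)
    rw [← γ.sum_repr (W.coeff i), map_sum]
    refine Submodule.sum_mem _ fun j _ => ?_
    rw [← smul_monomial]
    refine Submodule.smul_mem _ _ (Submodule.subset_span ⟨(j, ⟨i, hi0, hpi⟩), ?_⟩)
    exact polynomialBasis_apply γ j i

theorem mem_span_S_iff (γ : Module.Basis (Fin r) (ZMod p) F) {x : V p (RatFunc F)} :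
    x ∈ Submodule.span (ZMod p) (Set.range (S p γ)) ↔
      ∃ W : F[X], IsReduced p W ∧ W.coeff 0 = 0 ∧ (U p (RatFunc F)).mkQ (evalInv W) = x := by
  have h : Set.range (S p γ) = evalInvClass p F '' (Set.range
      fun x : Fin r × {i : ℕ // 0 < i ∧ ¬ p ∣ i} => polynomialBasis γ (x.1, x.2)) := by
    rw [← Set.range_comp]
    congr 1
    funext x
    exact S_eq γ x
  rw [h, Submodule.span_image, span_polynomialBasis, Submodule.mem_map]
  exact ⟨fun ⟨W, hW, h⟩ => ⟨W, hW.1, hW.2, h⟩, fun ⟨W, h1, h2, h⟩ => ⟨W, ⟨h1, h2⟩, h⟩⟩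

theorem mkQ_eq_zero_iff {K : Type*} [Field K] [Algebra (ZMod p) K] {u : K} :
    (U p K).mkQ u = 0 ↔ ∃ z : K, z ^ p - z = u := by
  rw [Submodule.mkQ_apply, Submodule.Quotient.mk_eq_zero]; rfl

/-- The family is the image of part of the basis `γ j * T ^ i`. On the span of that part `W ↦
W(1/t)` is injective modulo `℘`: a reduced `W` in the kernel is constant, hence `0` as its constant
term vanishes. -/
theorem linearIndependent_S (γ : Module.Basis (Fin r) (ZMod p) F) :
    LinearIndependent (ZMod p) (S p γ) := by
  have hinj : Function.Injective fun x : Fin r × {i : ℕ // 0 < i ∧ ¬ p ∣ i} =>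
      (x.1, (x.2 : ℕ)) := by
    rintro ⟨j, i⟩ ⟨j', i'⟩ h
    simpa [Subtype.ext_iff] using h
  have hli := (polynomialBasis γ).linearIndependent.comp _ hinj
  have h := hli.map (f := evalInvClass p F) (by
    rw [Function.comp_def, span_polynomialBasis, Submodule.disjoint_def]
    rintro W ⟨hW, hW0⟩ hker
    rw [LinearMap.mem_ker, evalInvClass_apply, mkQ_eq_zero_iff] at hker
    obtain ⟨z, hz⟩ := hker
    rw [eq_C_of_natDegree_eq_zero (natDegree_eq_zero_of_evalInv_eq hW hz), hW0, C_0])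
  have hS : S p γ = evalInvClass p F ∘ polynomialBasis γ ∘
      fun x : Fin r × {i : ℕ // 0 < i ∧ ¬ p ∣ i} => (x.1, (x.2 : ℕ)) := funext (S_eq γ)
  rw [hS]
  exact h

end Span

/-! ### The ramification and splitting criteria. -/

section Main

variable {p : ℕ} [hp : Fact p.Prime] {F : Type*} [Field F] [Finite F] [CharP F p]
  {Ω : Type*} [Field Ω] [Algebra (RatFunc F) Ω]

/-- An extension presented by `u` is presented by `u - (a ^ p - a)`. -/
theorem IsGeneratedBy.sub {K : Type*} [Field K] [CharP K p] [Algebra K Ω]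
    {L : IntermediateField K Ω} {u : K} {y : Ω} (h : IsGeneratedBy p L u y) (a : K) :
    IsGeneratedBy p L (u - (a ^ p - a)) (y - algebraMap K Ω a) := by
  have : CharP Ω p := charP_of_injective_algebraMap (algebraMap K Ω).injective p
  refine ⟨sub_algebraMap_pow_sub h.1 a, h.2.trans ?_⟩
  apply le_antisymm <;> rw [adjoin_simple_le_iff]
  · have := add_mem (mem_adjoin_simple_self K (y - algebraMap K Ω a))
      (K⟮y - algebraMap K Ω a⟯.algebraMap_mem a)
    rwa [sub_add_cancel] at this
  · exact sub_mem (mem_adjoin_simple_self K y) (K⟮y⟯.algebraMap_mem a)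

theorem IsGeneratedBy.exists_mem {p : ℕ} {K : Type*} [Field K] [Algebra K Ω]
    {L : IntermediateField K Ω} {u : K} {y : Ω} (h : IsGeneratedBy p L u y) :
    ∃ x : L, x ^ p - x = algebraMap K L u ∧ K⟮x⟯ = ⊤ := by
  obtain ⟨hy, rfl⟩ := h
  refine ⟨AdjoinSimple.gen K y, ?_, adjoin_gen_eq_top y⟩
  apply (algebraMap K⟮y⟯ Ω).injective
  simpa using hy

theorem IsCyclicOfDegree.exists_isGeneratedBy {K : Type*} [Field K] [CharP K p] [Algebra K Ω]
    {L : IntermediateField K Ω} (hL : IsCyclicOfDegree p L) :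
    ∃ (u : K) (y : Ω), IsGeneratedBy p L u y := by
  obtain ⟨hG, hC, hd⟩ := hL
  have : CharP L p := charP_of_injective_algebraMap (algebraMap K L).injective p
  obtain ⟨y, u, hy, hgen⟩ := exists_generator hd
  refine ⟨u, y, ?_, ?_⟩
  · have := congrArg (algebraMap L Ω) hy
    simpa using this
  · rw [← lift_adjoin_simple, hgen, lift_top]

variable {L : IntermediateField (RatFunc F) Ω}

theorem isUnramifiedOutsideZero_iff (hL : IsCyclicOfDegree p L) :
    IsUnramifiedOutsideZero F L ↔
      ∃ W : F[X], IsReduced p W ∧ ∃ y : Ω, IsGeneratedBy p L (evalInv W) y := by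
  have : CharP (RatFunc F) p :=
    charP_of_injective_algebraMap (algebraMap F (RatFunc F)).injective p
  have := hL.1
  have : FiniteDimensional (RatFunc F) L := .of_finrank_pos (hL.2.2 ▸ hp.out.pos)
  constructor
  · intro h
    obtain ⟨u, y, hy⟩ := hL.exists_isGeneratedBy
    obtain ⟨x, hx, -⟩ := hy.exists_mem
    obtain ⟨W, g, hW, hg⟩ := exists_isReduced_of_isUnramifiedOutsideZero h hx
    exact ⟨W, hW, _, hg ▸ hy.sub g⟩
  · rintro ⟨W, -, y, hy⟩ P hP hP0
    obtain ⟨x, hx, hgen⟩ := hy.exists_mem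
    exact isUnramified_of_mem (isArchimedean_of_ne_top hP) hx hgen
      (evalInv_mem (inv_X_mem hP hP0) W)

theorem isTotallySplit_inftyPlace_iff (hL : IsCyclicOfDegree p L) {W : F[X]} {y : Ω}
    (hy : IsGeneratedBy p L (evalInv W) y) :
    IsTotallySplit L (inftyPlace F) ↔ ∃ a : F, a ^ p - a = W.coeff 0 := by
  have : CharP (RatFunc F) p :=
    charP_of_injective_algebraMap (algebraMap F (RatFunc F)).injective p
  have := hL.1
  have : FiniteDimensional (RatFunc F) L := .of_finrank_pos (hL.2.2 ▸ hp.out.pos)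
  have : CharP L p := charP_of_injective_algebraMap (algebraMap (RatFunc F) L).injective p
  have hW := valuation_evalInv_sub_C_lt_one W
  rw [IsTotallySplit, hL.2.2]
  constructor
  · intro h
    obtain ⟨x, hx, hgen⟩ := hy.exists_mem
    by_contra hcon
    refine absurd (ncard_placesOver_of_inert hx hgen
      (evalInv_mem (inv_X_mem inftyPlace_ne_top inftyPlace_ne_zeroPlace) W) ?_)
      (by rw [h]; exact not_le.2 hp.out.one_lt)
    -- A solution modulo the place at infinity may be replaced by its residue `a` in `F`. Then `a ^
    -- p - a - W.coeff 0` is a constant of value less than `1`, hence zero.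
    intro z hz hlt
    obtain ⟨a, ha⟩ := exists_valuation_sub_C_lt_one hz
    refine hcon ⟨a, ?_⟩
    set v := (inftyPlace F).valuation
    have h1 : v ((z - algebraMap F (RatFunc F) a) ^ p - (z - algebraMap F (RatFunc F) a)) < 1 := by
      refine v.map_sub_lt ?_ ha
      rw [map_pow]
      exact pow_lt_one₀ zero_le ha hp.out.ne_zero
    rw [sub_pow_sub_sub] at h1
    have h2 := v.map_add_lt (v.map_sub_lt hlt h1) hW
    rw [show z ^ p - z - evalInv W - (z ^ p - z - (algebraMap F (RatFunc F) a ^ p -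
      algebraMap F (RatFunc F) a)) + (evalInv W - algebraMap F (RatFunc F) (W.coeff 0)) =
      algebraMap F (RatFunc F) (a ^ p - a - W.coeff 0) by simp only [map_sub, map_pow]; ring] at h2
    by_contra hne
    exact absurd (Valuation.IsTrivialOn.eq_one (v := v) _ (sub_ne_zero.2 hne)) h2.ne
  · rintro ⟨a, ha⟩
    obtain ⟨x, hx, hgen⟩ := (hy.sub (algebraMap F (RatFunc F) a)).exists_mem
    refine ncard_placesOver_of_split (isArchimedean_of_ne_top inftyPlace_ne_top) hx hgen ?_ hL.2.2
    rwa [← map_pow, ← map_sub, ha]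

theorem isUnramifiedOutsideZero_and_isTotallySplit_iff (hL : IsCyclicOfDegree p L) :
    IsUnramifiedOutsideZero F L ∧ IsTotallySplit L (inftyPlace F) ↔
      ∃ W : F[X], IsReduced p W ∧ W.coeff 0 = 0 ∧
        ∃ y : Ω, IsGeneratedBy p L (evalInv W) y := by
  have : CharP (RatFunc F) p :=
    charP_of_injective_algebraMap (algebraMap F (RatFunc F)).injective p
  rw [isUnramifiedOutsideZero_iff hL]
  constructor
  · rintro ⟨⟨W, hW, y, hy⟩, hs⟩
    obtain ⟨a, ha⟩ := (isTotallySplit_inftyPlace_iff hL hy).1 hs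
    -- Since `W.coeff 0 = ℘(a)`, translating `y` by `a` removes the constant term.
    refine ⟨W + C (-W.coeff 0), hW.add_C _, by simp,
      y - algebraMap _ Ω (algebraMap F (RatFunc F) a), ?_⟩
    convert hy.sub (algebraMap F (RatFunc F) a) using 1
    rw [← map_pow, ← map_sub, ha]
    simp [evalInv, sub_eq_add_neg]
  · rintro ⟨W, hW, hW0, y, hy⟩
    refine ⟨⟨W, hW, y, hy⟩, (isTotallySplit_inftyPlace_iff hL hy).2 ⟨0, ?_⟩⟩
    rw [hW0]; simp [hp.out.ne_zero]

theorem IsGeneratedBy.ne_of_isCyclicOfDegree {K : Type*} [Field K] [CharP K p] [Algebra K Ω]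
    {L : IntermediateField K Ω} {u : K} {y : Ω} (h : IsGeneratedBy p L u y)
    (hL : IsCyclicOfDegree p L) (z : K) : z ^ p - z ≠ u := by
  intro hz
  have : CharP Ω p := charP_of_injective_algebraMap (algebraMap K Ω).injective p
  obtain ⟨c, hc⟩ := exists_castHom_eq_sub (p := p) (x := y) (y := algebraMap K Ω z)
    (by rw [h.1, ← hz]; simp)
  rw [← algebraMap_castHom (K := K), eq_sub_iff_add_eq, ← map_add] at hc
  have hbot : K⟮y⟯ = ⊥ := by
    rw [adjoin_simple_eq_bot_iff, mem_bot]
    exact ⟨_, hc⟩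
  have hd := hL.2.2
  rw [h.2, hbot, IntermediateField.finrank_bot] at hd
  exact hp.out.one_lt.ne hd

theorem exists_root {K : Type*} [Field K] [CharP K p] [Algebra K Ω] [IsSepClosed Ω] (u : K) :
    ∃ y : Ω, y ^ p - y = algebraMap K Ω u := by
  have : CharP Ω p := charP_of_injective_algebraMap (algebraMap K Ω).injective p
  obtain ⟨y, hy⟩ := IsSepClosed.exists_root_C_mul_X_pow_add_C_mul_X_add_C (n := p) 1 (-1 : Ω)
    (-algebraMap K Ω u) (CharP.cast_eq_zero Ω p) hp.out.two_le (by simp)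
  exact ⟨y, by linear_combination hy⟩

end Main

end ArtinSchreier

theorem lemma2p1 (p : ℕ) [Fact p.Prime]
    (F : Type*) [Field F] [Finite F] [Algebra (ZMod p) F]
    {r : ℕ} (γ : Module.Basis (Fin r) (ZMod p) F)
    (Ω : Type*) [Field Ω] [Algebra (RatFunc F) Ω] [IsSepClosure (RatFunc F) Ω] :
    -- unramified outside `t = 0` iff given by some `y ^ p - y = W(1/t)` with `W` reduced
    (∀ L : IntermediateField (RatFunc F) Ω, ArtinSchreier.IsCyclicOfDegree p L →
      (ArtinSchreier.IsUnramifiedOutsideZero F L ↔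
        ∃ W : Polynomial F, ArtinSchreier.IsReduced p W ∧
          ∃ y : Ω, ArtinSchreier.IsGeneratedBy p L (ArtinSchreier.evalInv W) y)) ∧
    -- for every such presentation: infinity splits totally iff the constant term lies in `𝒰(F)`,
    -- which for `F` of prime order means that it is `0`
    (∀ L : IntermediateField (RatFunc F) Ω, ArtinSchreier.IsCyclicOfDegree p L →
      ∀ W : Polynomial F, ArtinSchreier.IsReduced p W →
        ∀ y : Ω, ArtinSchreier.IsGeneratedBy p L (ArtinSchreier.evalInv W) y →
          (ArtinSchreier.IsTotallySplit L (ArtinSchreier.inftyPlace F) ↔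
            W.coeff 0 ∈ ArtinSchreier.U p F) ∧
          (Nat.card F = p →
            (ArtinSchreier.IsTotallySplit L (ArtinSchreier.inftyPlace F) ↔ W.coeff 0 = 0))) ∧
    -- unramified outside `t = 0` and totally split at infinity iff `W` can be chosen with
    -- constant term `0`
    (∀ L : IntermediateField (RatFunc F) Ω, ArtinSchreier.IsCyclicOfDegree p L →
      (ArtinSchreier.IsUnramifiedOutsideZero F L ∧
          ArtinSchreier.IsTotallySplit L (ArtinSchreier.inftyPlace F) ↔
        ∃ W : Polynomial F, ArtinSchreier.IsReduced p W ∧ W.coeff 0 = 0 ∧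
          ∃ y : Ω, ArtinSchreier.IsGeneratedBy p L (ArtinSchreier.evalInv W) y)) ∧
    -- the `γ j / t ^ i` are independent in `𝒱(F(t))`
    LinearIndependent (ZMod p) (ArtinSchreier.S p γ) ∧
    -- the nonzero classes in their span give exactly the cyclic extensions of degree `p` that are
    -- unramified outside `t = 0` and totally split at infinity
    {L : IntermediateField (RatFunc F) Ω | ArtinSchreier.IsCyclicOfDegree p L ∧
        ArtinSchreier.IsUnramifiedOutsideZero F L ∧
        ArtinSchreier.IsTotallySplit L (ArtinSchreier.inftyPlace F)} =
      {L | ∃ u : RatFunc F,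
        (ArtinSchreier.U p (RatFunc F)).mkQ u ∈
          Submodule.span (ZMod p) (Set.range (ArtinSchreier.S p γ)) ∧
        (ArtinSchreier.U p (RatFunc F)).mkQ u ≠ 0 ∧
        L = ArtinSchreier.extensionOf p Ω u} := by
  have hF : CharP F p := charP_of_injective_algebraMap (algebraMap (ZMod p) F).injective p
  have : CharP (RatFunc F) p :=
    charP_of_injective_algebraMap (algebraMap F (RatFunc F)).injective p
  have : CharP Ω p := charP_of_injective_algebraMap (algebraMap (RatFunc F) Ω).injective p
  have : IsSepClosed Ω := IsSepClosure.sep_closed (RatFunc F)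
  open ArtinSchreier in
  refine ⟨fun L hL => isUnramifiedOutsideZero_iff hL, fun L hL W hW y hy => ?_,
    fun L hL => isUnramifiedOutsideZero_and_isTotallySplit_iff hL, linearIndependent_S γ, ?_⟩
  · have h := isTotallySplit_inftyPlace_iff hL hy
    refine ⟨h, fun hcard => h.trans ⟨fun ⟨a, ha⟩ => ?_, fun h0 => ⟨0, ?_⟩⟩⟩
    · have := Fintype.ofFinite F
      rw [← ha, ← hcard, ← Fintype.card_eq_nat_card, FiniteField.pow_card, sub_self]
    · rw [h0, zero_pow (Fact.out : p.Prime).ne_zero, sub_zero]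
  · ext L
    simp only [Set.mem_ofPred_eq]
    constructor
    · rintro ⟨hL, h⟩
      obtain ⟨W, hW, hW0, y, hy⟩ := (isUnramifiedOutsideZero_and_isTotallySplit_iff hL).1 h
      refine ⟨evalInv W, (mem_span_S_iff γ).2 ⟨W, hW, hW0, rfl⟩, fun h0 => ?_, ?_⟩
      · obtain ⟨z, hz⟩ := mkQ_eq_zero_iff.1 h0
        exact hy.ne_of_isCyclicOfDegree hL z hz
      · rw [extensionOf_eq_adjoin hy.1, hy.2]
    · rintro ⟨u, hu, hu0, rfl⟩
      obtain ⟨y, hy⟩ := exists_root (p := p) (Ω := Ω) u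
      rw [extensionOf_eq_adjoin hy]
      have hL := isCyclicOfDegree_adjoin hy fun z hz => hu0 (mkQ_eq_zero_iff.2 ⟨z, hz⟩)
      refine ⟨hL, (isUnramifiedOutsideZero_and_isTotallySplit_iff hL).2 ?_⟩
      obtain ⟨W, hW, hW0, h⟩ := (mem_span_S_iff γ).1 hu
      rw [← sub_eq_zero, ← map_sub, mkQ_eq_zero_iff] at h
      obtain ⟨z, hz⟩ := h
      refine ⟨W, hW, hW0, y - algebraMap _ _ (-z), ?_⟩
      have hg : IsGeneratedBy p (IntermediateField.adjoin (RatFunc F) {y}) u y := ⟨hy, rfl⟩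
      convert hg.sub (-z) using 1
      -- Additivity of `℘` gives `℘(-z) = -℘(z)` without separating `p = 2` from odd `p`.
      have h0 := sub_pow_sub_sub (p := p) (0 : RatFunc F) z
      rw [zero_sub, zero_pow (Fact.out : p.Prime).ne_zero] at h0
      rw [h0, hz]
      ring
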